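/- **Setting.** Let $0<q<1$, $a=2|\ln q|$, and let $L\ge 0$ be an even integer. For $x\in\mathbb Z^3$ put $l(x)=x^1+x^2+x^3$. Let $\Sigma_0$ be the finite stick consisting of the $L+1$ sites with $-L/2\le l\le L/2$ of the sequence $\dots,-e_2-e_3,\,-e_3,\,0,\,e_1,\,e_1+e_2,\,e_1+e_2+e_3,\dots$. Let $\Gamma_R\subseteq\Gamma$ be finite sets of sites of the plane $\{l(x)=0\}$, with $\Gamma_R\neq\emptyset$. Let $\Lambda=\Gamma+\Sigma_0$ and $\Lambda_R=\Gamma_R+\Sigma_0$ be the cylinders with these bases, and put $A=|\Gamma|$, $A_R=|\Gamma_R|$, so that $|\Lambda|=(L+1)A$. On $(\mathbb C^2)^{\otimes\Lambda}$, with the orthonormal basis $|\alpha\rangle$, $\alpha\in\{0,1\}^\Lambda$ ($0=\uparrow$, $1=\downarrow$), let $$\psi_0=\sum_{\alpha:\ \sum_x\alpha(x)=n}\ \prod_{x\in\Lambda}q^{l(x)\alpha(x)}\,|\alpha\rangle,\qquad \psi=\sum_{\alpha:\ \sum_x\alpha(x)=n}\ \prod_{x\in\Lambda}e^{i\phi(x)\alpha(x)}q^{l(x)\alpha(x)}\,|\alpha\rangle,$$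 and let $T(\phi)=\bigotimes_{x\in\Lambda}\big(|\uparrow\rangle\langle\uparrow|+e^{i\phi(x)}|\downarrow\rangle\langle\downarrow|\big)$, so that $\psi=T(\phi)\psi_0$. For $\mu\in\mathbb R$ let $\langle X\rangle^{GC}_{\Lambda,\mu}$ be the expectation of $X$ in the (normalized) product vector $\bigotimes_{x\in\Lambda}(|\uparrow\rangle+q^{l(x)-\mu}|\downarrow\rangle)$; let $\langle \mathsf N\rangle^{GC}_{\Sigma_0,\mu}$ be the corresponding mean particle number of the stick $\Sigma_0$. **Theorem.** (1) Let $n\in\mathbb{N}$, let $\phi$ be a real function vanishing outside $\Lambda_R$, suppose that $\mu$ satisfies $\langle \mathsf N\rangle^{GC}_{\Sigma_0,\mu}=\frac{n}{|\Lambda|}(L+1)$, and suppose that $2A_R<q^2A^{1/2}$. Then $$\left|\frac{\langle\psi_0|\psi\rangle}{\langle\psi_0|\psi_0\rangle}-\langle T(\phi)\rangle^{GC}_{\Lambda,\mu}\right|\le\frac{\ln^2(A-A_R)+2(1+a^2)A_R^2+4}{2(A-A_R)}+\frac{4A_R}{q^2A^{1/2}-2A_R}.$$ (2) Let $-L/2\le\mu\le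 L/2$, $R>0$, $\mathcal S\in\mathbb R$, and let $\tilde\phi:\mathbb R^2\to\mathbb R$ be smooth. Put $$\phi(x)=\frac{\mathcal S}{R}\,\tilde\phi\Big(\frac{2x^1-x^2-x^3}{\sqrt6\,R},\frac{x^2-x^3}{\sqrt2\,R}\Big)\ \text{ for }x\in\Lambda_R,\qquad \phi(x)=0\ \text{ for }x\notin\Lambda_R.$$ In the orthonormal coordinates $\big((2x^1-x^2-x^3)/\sqrt6,\ (x^2-x^3)/\sqrt2\big)$ of the plane $l=0$, let $\Omega_R\subset\mathbb R^2$ be the union of the closed Voronoi domains of the sites of $\Gamma_R$ (with respect to all lattice sites of that plane), let $\tilde\Omega=\{y: Ry\in\Omega_R\}$, and let $m(\tilde\Omega)$ be its area. Then $$\ln\left|\langle T(\phi)\rangle^{GC}_{\Lambda,\mu}\right|^2\le-q^{2\delta(\mu)}\frac{A_R\mathcal S^2}{4R^2}\left[\frac{\|\tilde\phi\|^2_{L^2(\tilde\Omega)}}{m(\tilde\Omega)}-\frac{\sqrt6}{R}\|\partial\tilde\phi\|_{L^\infty}\|\tilde\phi\|_{L^\infty}-\frac{\mathcal S^2}{12R^2}\|\tilde\phi\|^4_{L^\infty}\right],$$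 where $\ln 0=-\infty$, $\delta(\mu)$ is the distance of $\mu$ from the closest integer, the $L^\infty$ norms are taken on $\tilde\Omega$, and $\|\partial\tilde\phi\|_{L^\infty}$ is the larger of the $L^\infty$ norms of the two first partial derivatives. -/

import Mathlib

open scoped ContDiff

noncomputable section

namespace XXZ

/-! ### Lattice geometry -/

/-- Sites of the cubic lattice. -/
abbrev Site : Type := Fin 3 → ℤ

/-- The signed distance of a site along the 111 direction. -/
def level (x : Site) : ℤ := x 0 + x 1 + x 2

/-- The site at level `l` of the infinite stick
`…, -e₂-e₃, -e₃, 0, e₁, e₁+e₂, e₁+e₂+e₃, e₁+e₂+e₃+e₁, …` (integer division rounds down). -/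
def stickSite (l : ℤ) : Site := ![(l + 2) / 3, (l + 1) / 3, l / 3]

/-- The finite stick of length `L + 1` through the origin, for even `L`. -/
def stick (L : ℕ) : Finset Site :=
  (Finset.Icc (-((L : ℤ) / 2)) ((L : ℤ) / 2)).image stickSite

/-- The cylindrical volume `{x + y | x ∈ Γ, y ∈ stick L}` with base `Γ`. -/
def cylinder (Γ : Finset Site) (L : ℕ) : Finset Site :=
  Finset.image₂ (fun x y => x + y) Γ (stick L)

/-! ### States and operators -/

/-- Particle configurations: `0` is spin up (empty), `1` is spin down (occupied). -/
abbrev Config (Λ : Finset Site) : Type := Λ → Fin 2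

/-- The number of particles of a configuration. -/
def particleNumber {Λ : Finset Site} (α : Config Λ) : ℕ := ∑ x, (α x : ℕ)

/-- The Hilbert space `(ℂ²)^{⊗ Λ}`, in coordinates with respect to its orthonormal basis of
configurations. -/
abbrev State (Λ : Finset Site) : Type := EuclideanSpace ℂ (Config Λ)

/-- The ground state `ψ₀(Λ, n)`. -/
def groundState (q : ℝ) (Λ : Finset Site) (n : ℕ) : State Λ :=
  WithLp.toLp 2 fun α =>
    if particleNumber α = n then
      ∏ x : Λ, ((q ^ (level x * (α x : ℕ)) : ℝ) : ℂ)
    else 0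

/-- The perturbed state `ψ(Λ, n, φ)`. -/
def perturbedState (q : ℝ) (Λ : Finset Site) (n : ℕ) (φ : Site → ℝ) : State Λ :=
  WithLp.toLp 2 fun α =>
    if particleNumber α = n then
      ∏ x : Λ, Complex.exp (Complex.I * φ x * (α x : ℕ)) *
        ((q ^ (level x * (α x : ℕ)) : ℝ) : ℂ)
    else 0

/-- The grand canonical vector `ψ^GC(Λ, μ) = ⨂ₓ (|↑⟩ + q^(l(x) - μ) |↓⟩)`. -/
def gcState (q : ℝ) (Λ : Finset Site) (μ : ℝ) : State Λ :=
  WithLp.toLp 2 fun α =>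
    ∏ x : Λ, ((q ^ (((level x : ℝ) - μ) * (α x : ℕ)) : ℝ) : ℂ)

/-- The operator that is diagonal in the basis of configurations, with diagonal `d`. -/
def diagonalOp {Λ : Finset Site} (d : Config Λ → ℂ) : State Λ →ₗ[ℂ] State Λ where
  toFun v := WithLp.toLp 2 fun α => d α * v α
  map_add' v w := by
    ext α
    simp [mul_add]
  map_smul' c v := by
    ext α
    simp [mul_left_comm]

/-- The number operator. -/
def numberOp (Λ : Finset Site) : State Λ →ₗ[ℂ] State Λ :=
  diagonalOp fun α => (particleNumber α : ℂ)

/-- The unitary `T(φ) = ⨂ₓ (|↑⟩⟨↑| + e^{i φ(x)} |↓⟩⟨↓|)`. -/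
def phaseOp (Λ : Finset Site) (φ : Site → ℝ) : State Λ →ₗ[ℂ] State Λ :=
  diagonalOp fun α => ∏ x : Λ, if α x = 1 then Complex.exp (Complex.I * φ x) else 1

/-- The grand canonical expectation `⟨X⟩^GC_{Λ, μ}`. -/
def gcExpectation (q : ℝ) (Λ : Finset Site) (μ : ℝ) (X : State Λ →ₗ[ℂ] State Λ) : ℂ :=
  inner ℂ (gcState q Λ μ) (X (gcState q Λ μ)) / inner ℂ (gcState q Λ μ) (gcState q Λ μ)

/-! ### The plane perpendicular to the 111 direction -/

/-- Orthonormal coordinates of the component of `x` perpendicular to the 111 direction. -/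
def planeCoord (x : Site) : EuclideanSpace ℝ (Fin 2) :=
  !₂[(2 * (x 0 : ℝ) - x 1 - x 2) / √6, ((x 1 : ℝ) - x 2) / √2]

/-- The (closed) Voronoi domain of the site `x` of the plane `l = 0`, with respect to all sites
of this plane. -/
def voronoiCell (x : Site) : Set (EuclideanSpace ℝ (Fin 2)) :=
  {y | ∀ z : Site, level z = 0 → dist y (planeCoord x) ≤ dist y (planeCoord z)}

/-- The region of the plane `l = 0` occupied by the base `Γ`. -/
def baseRegion (Γ : Finset Site) : Set (EuclideanSpace ℝ (Fin 2)) :=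
  ⋃ x ∈ Γ, voronoiCell x

/-- The rescaled region `{y | R y ∈ Ω}`, where `Ω` is the region occupied by `Γ`. -/
def rescaledRegion (R : ℝ) (Γ : Finset Site) : Set (EuclideanSpace ℝ (Fin 2)) :=
  {y | R • y ∈ baseRegion Γ}

/-- The phases `φ(x) = (S / R) f(x_⊥ / R)` inside `Λ₀`, and `0` outside. -/
def ansatzPhase (S R : ℝ) (f : EuclideanSpace ℝ (Fin 2) → ℝ) (Λ₀ : Finset Site)
    (x : Site) : ℝ :=
  if x ∈ Λ₀ then S / R * f (R⁻¹ • planeCoord x) else 0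

/-- The sup norm of `f` on `Ω` (used for continuous `f` and compact nonempty `Ω`). -/
def supNorm (Ω : Set (EuclideanSpace ℝ (Fin 2))) (f : EuclideanSpace ℝ (Fin 2) → ℝ) : ℝ :=
  ⨆ y : Ω, |f y|

/-- The larger of the sup norms on `Ω` of the two partial derivatives of `f`. -/
def derivSupNorm (Ω : Set (EuclideanSpace ℝ (Fin 2)))
    (f : EuclideanSpace ℝ (Fin 2) → ℝ) : ℝ :=
  max (supNorm Ω fun y => fderiv ℝ f y (EuclideanSpace.single 0 1))
    (supNorm Ω fun y => fderiv ℝ f y (EuclideanSpace.single 1 1))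

/-- The distance of `μ` from the closest integer. -/
def latticeDist (μ : ℝ) : ℝ := min |μ - ⌊μ⌋| |1 - μ + ⌊μ⌋|

end XXZ

end

noncomputable section

namespace XXZ

section

open Polynomial Finset

/-! ### Generating polynomials of Poisson binomial distributions -/

/-- The generating polynomial of a sum of independent Bernoulli variables with parameters `p i`,
each carrying the weight `z i` when it is `1`. -/
def bernPoly {ι K : Type*} [CommRing K] (s : Finset ι) (p z : ι → K) : K[X] :=
  ∏ i ∈ s, (C (1 - p i) + C (p i * z i) * X)

/-- Coefficients of a polynomial, extended by zero to negative indices. -/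
def zcoeff {K : Type*} [CommRing K] (P : K[X]) (j : ℤ) : K :=
  if 0 ≤ j then P.coeff j.toNat else 0

section zcoeff
variable {K : Type*} [CommRing K]

@[simp] lemma zcoeff_natCast (P : K[X]) (n : ℕ) : zcoeff P n = P.coeff n := by
  simp [zcoeff]

lemma zcoeff_neg (P : K[X]) {j : ℤ} (h : j < 0) : zcoeff P j = 0 := by
  simp [zcoeff, not_le.2 h]

lemma zcoeff_linear_mul (a b : K) (P : K[X]) (j : ℤ) :
    zcoeff ((C a + C b * X) * P) j = a * zcoeff P j + b * zcoeff P (j - 1) := by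
  rcases lt_trichotomy j 0 with h | h | h
  · simp [zcoeff_neg P h, zcoeff_neg P (show j - 1 < 0 by omega), zcoeff_neg _ h]
  · subst h
    simp [zcoeff, mul_assoc, add_mul]
  · obtain ⟨k, rfl⟩ : ∃ k : ℕ, j = (k + 1 : ℕ) := ⟨(j - 1).toNat, by omega⟩
    have : ((k + 1 : ℕ) : ℤ) - 1 = (k : ℕ) := by push_cast; ring
    rw [this]
    simp only [zcoeff_natCast, add_mul, coeff_add, mul_assoc, coeff_C_mul]
    rw [coeff_X_mul]

lemma coeff_mul_eq_sum_zcoeff (P Q : K[X]) {n T : ℕ} (h : n < T) :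
    (P * Q).coeff n = ∑ k ∈ range T, P.coeff k * zcoeff Q ((n : ℤ) - k) := by
  rw [coeff_mul, Nat.sum_antidiagonal_eq_sum_range_succ (fun i j => P.coeff i * Q.coeff j)]
  rw [← sum_subset (range_subset_range.2 (Nat.succ_le_of_lt h))]
  · refine sum_congr rfl fun k hk => ?_
    rw [mem_range] at hk
    rw [show (n : ℤ) - k = ((n - k : ℕ) : ℤ) by omega, zcoeff_natCast]
  · intro k _ hk
    rw [mem_range, not_lt] at hk
    rw [zcoeff_neg _ (by omega), mul_zero]

end zcoeff

section bernPoly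
variable {ι : Type*}

lemma bernPoly_insert {K : Type*} [CommRing K] [DecidableEq ι] {s : Finset ι} {i : ι}
    (hi : i ∉ s) (p z : ι → K) :
    bernPoly (insert i s) p z = (C (1 - p i) + C (p i * z i) * X) * bernPoly s p z := by
  simp [bernPoly, prod_insert hi]

lemma natDegree_bernPoly_le {K : Type*} [CommRing K] (s : Finset ι) (p z : ι → K) :
    (bernPoly s p z).natDegree ≤ #s := by
  refine (natDegree_prod_le _ _).trans ?_
  rw [card_eq_sum_ones]
  exact sum_le_sum fun i _ => by
    rw [add_comm]
    exact natDegree_linear_le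

lemma eval_one_bernPoly {K : Type*} [CommRing K] (s : Finset ι) (p : ι → K) :
    (bernPoly s p 1).eval 1 = 1 := by
  simp [bernPoly, eval_prod]

variable {p : ι → ℝ}

lemma zcoeff_bernPoly_nonneg (s : Finset ι) (h0 : ∀ i ∈ s, 0 ≤ p i) (h1 : ∀ i ∈ s, p i ≤ 1)
    (j : ℤ) : 0 ≤ zcoeff (bernPoly s p 1) j := by
  classical
  induction s using Finset.induction_on generalizing j with
  | empty =>
    rcases lt_or_ge j 0 with h | h
    · simp [zcoeff_neg _ h]
    · simp only [zcoeff, h, bernPoly, prod_empty, coeff_one, if_true]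
      split_ifs <;> norm_num
  | insert i s hi ih =>
    rw [bernPoly_insert hi, zcoeff_linear_mul]
    have hi0 := h0 i (mem_insert_self i s)
    have hi1 := h1 i (mem_insert_self i s)
    have ih' := ih (fun k hk => h0 k (mem_insert_of_mem hk)) (fun k hk => h1 k (mem_insert_of_mem hk))
    have := ih' j
    have := ih' (j - 1)
    simp only [Pi.one_apply, mul_one]
    have := sub_nonneg.2 hi1
    positivity

lemma coeff_bernPoly_nonneg (s : Finset ι) (h0 : ∀ i ∈ s, 0 ≤ p i) (h1 : ∀ i ∈ s, p i ≤ 1)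
    (n : ℕ) : 0 ≤ (bernPoly s p 1).coeff n := by
  simpa using zcoeff_bernPoly_nonneg s h0 h1 n

lemma norm_zcoeff_bernPoly_le (s : Finset ι) (h0 : ∀ i ∈ s, 0 ≤ p i) (h1 : ∀ i ∈ s, p i ≤ 1)
    (z : ι → ℂ) (hz : ∀ i ∈ s, ‖z i‖ ≤ 1) (j : ℤ) :
    ‖zcoeff (bernPoly s (fun i => (p i : ℂ)) z) j‖ ≤ zcoeff (bernPoly s p 1) j := by
  classical
  induction s using Finset.induction_on generalizing j with
  | empty =>
    rcases lt_or_ge j 0 with h | h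
    · simp [zcoeff_neg _ h]
    · simp only [zcoeff, h, bernPoly, prod_empty, coeff_one, if_true]
      split_ifs <;> simp
  | insert i s hi ih =>
    rw [bernPoly_insert hi, zcoeff_linear_mul, bernPoly_insert hi, zcoeff_linear_mul]
    have hi0 := h0 i (mem_insert_self i s)
    have hi1 := h1 i (mem_insert_self i s)
    have hzi := hz i (mem_insert_self i s)
    have ih' := ih (fun k hk => h0 k (mem_insert_of_mem hk))
      (fun k hk => h1 k (mem_insert_of_mem hk)) (fun k hk => hz k (mem_insert_of_mem hk))
    refine (norm_add_le _ _).trans (add_le_add ?_ ?_)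
    · rw [norm_mul, ← Complex.ofReal_one, ← Complex.ofReal_sub, Complex.norm_real,
        Real.norm_of_nonneg (sub_nonneg.2 hi1)]
      exact mul_le_mul_of_nonneg_left (ih' j) (sub_nonneg.2 hi1)
    · rw [norm_mul, norm_mul, Complex.norm_real, Real.norm_of_nonneg hi0]
      refine mul_le_mul ?_ (ih' _) (norm_nonneg _) (by simpa using hi0)
      simpa using mul_le_of_le_one_right hi0 hzi

lemma coeff_bernPoly_pos (s : Finset ι) (h0 : ∀ i ∈ s, 0 < p i) (h1 : ∀ i ∈ s, p i < 1)
    {n : ℕ} (hn : n ≤ #s) : 0 < (bernPoly s p 1).coeff n := by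
  classical
  induction s using Finset.induction_on generalizing n with
  | empty =>
    obtain rfl : n = 0 := by simpa using hn
    simp [bernPoly]
  | insert i s hi ih =>
    have hi0 := h0 i (mem_insert_self i s)
    have hi1 := sub_pos.2 (h1 i (mem_insert_self i s))
    have h0' := fun k hk => h0 k (mem_insert_of_mem hk)
    have h1' := fun k hk => h1 k (mem_insert_of_mem hk)
    have ih' := fun {n} => @ih h0' h1' n
    have hnn := zcoeff_bernPoly_nonneg s (fun k hk => (h0' k hk).le) (fun k hk => (h1' k hk).le)
    rw [← zcoeff_natCast, bernPoly_insert hi, zcoeff_linear_mul]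
    simp only [Pi.one_apply, mul_one]
    rw [card_insert_of_notMem hi] at hn
    rcases Nat.lt_or_ge n (#s + 1) with h | h
    · have := ih' (n := n) (by omega)
      have h2 := hnn (n - 1)
      rw [zcoeff_natCast]
      positivity
    · obtain rfl : n = #s + 1 := by omega
      have := ih' (n := #s) le_rfl
      have h2 := hnn ((#s + 1 : ℕ) : ℤ)
      rw [show ((#s + 1 : ℕ) : ℤ) - 1 = (#s : ℕ) by push_cast; ring, zcoeff_natCast (n := #s)]
      positivity

/-- Poisson binomial distributions are log-concave. -/
lemma zcoeff_bernPoly_mul_le (s : Finset ι) (h0 : ∀ i ∈ s, 0 ≤ p i) (h1 : ∀ i ∈ s, p i ≤ 1)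
    (a b c d : ℤ) (hca : c ≤ a) (hcb : c ≤ b) (h : c + d = a + b) :
    zcoeff (bernPoly s p 1) c * zcoeff (bernPoly s p 1) d ≤
      zcoeff (bernPoly s p 1) a * zcoeff (bernPoly s p 1) b := by
  classical
  induction s using Finset.induction_on generalizing a b c d with
  | empty =>
    have key : ∀ j : ℤ, zcoeff (bernPoly (∅ : Finset ι) p 1) j = if j = 0 then 1 else 0 := by
      intro j
      simp only [zcoeff, bernPoly, prod_empty, coeff_one]
      split_ifs <;> first | rfl | omega
    simp only [key]
    split_ifs <;> first | omega | norm_num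
  | insert i s hi ih =>
    have hi0 := h0 i (mem_insert_self i s)
    have hi1 := sub_nonneg.2 (h1 i (mem_insert_self i s))
    have ih' := ih (fun k hk => h0 k (mem_insert_of_mem hk))
      (fun k hk => h1 k (mem_insert_of_mem hk))
    rw [bernPoly_insert hi]
    simp only [zcoeff_linear_mul, Pi.one_apply, mul_one]
    generalize hf : zcoeff (bernPoly s p 1) = f at ih' ⊢
    have e1 := ih' a b c d hca hcb h
    have e2 := ih' (a - 1) (b - 1) (c - 1) (d - 1) (by omega) (by omega) (by omega)
    have e3 : f c * f (d - 1) + f (c - 1) * f d ≤ f a * f (b - 1) + f (a - 1) * f b := by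
      rcases eq_or_lt_of_le hca with rfl | hca
      · obtain rfl : d = b := by omega
        exact le_rfl
      rcases eq_or_lt_of_le hcb with rfl | hcb
      · obtain rfl : d = a := by omega
        linarith [mul_comm (f c) (f (d - 1)), mul_comm (f (c - 1)) (f d)]
      have := ih' a (b - 1) c (d - 1) hca.le (by omega) (by omega)
      have := ih' (a - 1) b (c - 1) d (by omega) (by omega) (by omega)
      linarith
    have := mul_le_mul_of_nonneg_left e1 (mul_nonneg hi1 hi1)
    have := mul_le_mul_of_nonneg_left e2 (mul_nonneg hi0 hi0)
    have := mul_le_mul_of_nonneg_left e3 (mul_nonneg hi1 hi0)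
    nlinarith

end bernPoly

section moments

lemma sum_coeff_eq_eval_one {K : Type*} [CommRing K] (P : K[X]) {T : ℕ} (h : P.natDegree < T) :
    ∑ k ∈ range T, P.coeff k = P.eval 1 := by
  rw [eval_eq_sum_range' h]
  simp

lemma sum_coeff_linear_mul {K : Type*} [CommRing K] (a b : K) (P : K[X]) {T : ℕ}
    (h : P.natDegree < T) (g : ℕ → K) :
    ∑ k ∈ range (T + 1), ((C a + C b * X) * P).coeff k * g k =
      a * ∑ k ∈ range T, P.coeff k * g k + b * ∑ k ∈ range T, P.coeff k * g (k + 1) := by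
  have e : ∀ k : ℕ, ((C a + C b * X) * P).coeff k * g k =
      a * (P.coeff k * g k) + b * ((X * P).coeff k * g k) := by
    intro k
    rw [add_mul, mul_assoc, coeff_add, coeff_C_mul, coeff_C_mul]
    ring
  simp only [e, sum_add_distrib, ← mul_sum]
  congr 2
  · rw [sum_range_succ, coeff_eq_zero_of_natDegree_lt h, zero_mul, add_zero]
  · rw [sum_range_succ']
    simp [coeff_X_mul]

variable {ι : Type*} {p : ι → ℝ}

lemma bernPoly_first_moment (s : Finset ι) {T : ℕ} (hT : #s < T) (c : ℝ) :
    ∑ k ∈ range T, (bernPoly s p 1).coeff k * (k - c) = ∑ i ∈ s, p i - c := by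
  classical
  induction s using Finset.induction_on generalizing T c with
  | empty =>
    obtain ⟨T, rfl⟩ : ∃ t, T = t + 1 := ⟨T - 1, by omega⟩
    simp [bernPoly, coeff_one]
  | insert i s hi ih =>
    rw [card_insert_of_notMem hi] at hT
    obtain ⟨T, rfl⟩ : ∃ t, T = t + 1 := ⟨T - 1, by omega⟩
    rw [bernPoly_insert hi,
      sum_coeff_linear_mul _ _ _ (lt_of_le_of_lt (natDegree_bernPoly_le _ _ _) (by omega)),
      ih (by omega), sum_insert hi]
    have : ∀ k : ℕ, ((k + 1 : ℕ) : ℝ) - c = k - (c - 1) := by intro k; push_cast; ring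
    simp only [this]
    rw [ih (by omega)]
    simp only [Pi.one_apply]
    ring

lemma bernPoly_second_moment (s : Finset ι) {T : ℕ} (hT : #s < T) (c : ℝ) :
    ∑ k ∈ range T, (bernPoly s p 1).coeff k * ((k : ℝ) - c) ^ 2 =
      ∑ i ∈ s, p i * (1 - p i) + (∑ i ∈ s, p i - c) ^ 2 := by
  classical
  induction s using Finset.induction_on generalizing T c with
  | empty =>
    obtain ⟨T, rfl⟩ : ∃ t, T = t + 1 := ⟨T - 1, by omega⟩
    simp [bernPoly, coeff_one]
  | insert i s hi ih =>
    rw [card_insert_of_notMem hi] at hT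
    obtain ⟨T, rfl⟩ : ∃ t, T = t + 1 := ⟨T - 1, by omega⟩
    rw [bernPoly_insert hi,
      sum_coeff_linear_mul _ _ _ (lt_of_le_of_lt (natDegree_bernPoly_le _ _ _) (by omega)),
      ih (by omega), sum_insert hi, sum_insert hi]
    have : ∀ k : ℕ, ((k + 1 : ℕ) : ℝ) - c = k - (c - 1) := by intro k; push_cast; ring
    simp only [this]
    rw [ih (by omega)]
    simp only [Pi.one_apply]
    ring

lemma bernPoly_sum_abs_le (s : Finset ι) {T : ℕ} (hT : #s < T)
    (h0 : ∀ i ∈ s, 0 ≤ p i) (h1 : ∀ i ∈ s, p i ≤ 1) {c : ℝ} (hc : ∑ i ∈ s, p i = c) :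
    ∑ k ∈ range T, (bernPoly s p 1).coeff k * |(k : ℝ) - c| ≤ √(∑ i ∈ s, p i * (1 - p i)) := by
  have hnn := coeff_bernPoly_nonneg s h0 h1
  have hs := sum_coeff_eq_eval_one (bernPoly s p 1)
    (lt_of_le_of_lt (natDegree_bernPoly_le _ _ _) hT)
  rw [eval_one_bernPoly] at hs
  have h2 := bernPoly_second_moment (p := p) s hT c
  rw [hc, sub_self, zero_pow two_ne_zero, add_zero] at h2
  refine Real.le_sqrt_of_sq_le ?_
  rw [← h2]
  have := sum_mul_sq_le_sq_mul_sq (range T) (fun k => √((bernPoly s p 1).coeff k))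
    (fun k => √((bernPoly s p 1).coeff k) * |(k : ℝ) - c|)
  simpa only [← mul_assoc, Real.mul_self_sqrt (hnn _), Real.sq_sqrt (hnn _), hs, one_mul, mul_pow,
    sq_abs] using this

lemma bernPoly_sum_abs_sub_le (s : Finset ι) {T : ℕ} (hT : #s < T)
    (h0 : ∀ i ∈ s, 0 ≤ p i) (h1 : ∀ i ∈ s, p i ≤ 1) :
    ∑ k ∈ range T, ∑ j ∈ range T, (bernPoly s p 1).coeff k * (bernPoly s p 1).coeff j *
      |(k : ℝ) - j| ≤ √(2 * ∑ i ∈ s, p i * (1 - p i)) := by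
  have hnn := coeff_bernPoly_nonneg s h0 h1
  have hs := sum_coeff_eq_eval_one (bernPoly s p 1)
    (lt_of_le_of_lt (natDegree_bernPoly_le _ _ _) hT)
  rw [eval_one_bernPoly] at hs
  set c := ∑ i ∈ s, p i with hc
  have h1 := bernPoly_first_moment (p := p) s hT c
  have h2 := bernPoly_second_moment (p := p) s hT c
  rw [← hc, sub_self] at h1
  rw [← hc, sub_self, zero_pow two_ne_zero, add_zero] at h2
  set h := (bernPoly s p 1).coeff
  have key : ∑ k ∈ range T, ∑ j ∈ range T, h k * h j * ((k : ℝ) - j) ^ 2 =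
      2 * ∑ i ∈ s, p i * (1 - p i) := by
    have e : ∀ k j : ℕ, h k * h j * ((k : ℝ) - j) ^ 2 =
        (h k * (k - c) ^ 2) * h j + h k * (h j * (j - c) ^ 2) -
          2 * ((h k * (k - c)) * (h j * (j - c))) := by intro k j; ring
    simp only [e, sum_sub_distrib, sum_add_distrib, ← mul_sum, ← sum_mul, hs, h1, h2]
    ring
  refine Real.le_sqrt_of_sq_le ?_
  rw [← key, ← sum_product', ← sum_product']
  have := sum_mul_sq_le_sq_mul_sq (range T ×ˢ range T) (fun k => √(h k.1 * h k.2))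
    (fun k => √(h k.1 * h k.2) * |(k.1 : ℝ) - k.2|)
  have hh : ∑ x ∈ range T ×ˢ range T, h x.1 * h x.2 = 1 := by
    rw [sum_product' (f := fun k j => h k * h j)]
    simp only [← mul_sum, ← sum_mul, hs, one_mul]
  have hnn' : ∀ x : ℕ × ℕ, 0 ≤ h x.1 * h x.2 := fun x => mul_nonneg (hnn _) (hnn _)
  simpa only [← mul_assoc, Real.mul_self_sqrt (hnn' _), Real.sq_sqrt (hnn' _), hh, one_mul,
    mul_pow, sq_abs] using this

end moments

/-! ### Families with monotone likelihood ratio -/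

section coupling

variable {T : ℕ} {h : ℕ → ℝ} {f : ℤ → ℝ}

lemma two_smul_cross_sum {E : Type*} [AddCommGroup E] [Module ℝ E] (s : ℕ → E) (h : ℕ → ℝ)
    (u v : ℕ → ℝ) (T : ℕ) :
    (2 : ℝ) • ((∑ j ∈ range T, h j * v j) • ∑ k ∈ range T, u k • s k -
        (∑ j ∈ range T, h j * u j) • ∑ k ∈ range T, v k • s k) =
      ∑ k ∈ range T, ∑ j ∈ range T, (u k * v j - u j * v k) • (h j • s k - h k • s j) := by
  have e : ∀ k j : ℕ, (u k * v j - u j * v k) • (h j • s k - h k • s j) =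
      ((h j * v j) • (u k • s k) - (h j * u j) • (v k • s k)) +
      ((h k * v k) • (u j • s j) - (h k * u k) • (v j • s j)) := by
    intro k j
    module
  simp only [e, sum_add_distrib, sum_sub_distrib, ← smul_sum, ← sum_smul]
  module

/-- If a nonnegative weight is tilted by a family with monotone likelihood ratio, then averages of
bounded functions change at most by twice the change of the mean. -/
lemma norm_tilted_sub_le {E : Type*} [NormedAddCommGroup E] [NormedSpace ℝ E] (s : ℕ → E)
    (u v : ℕ → ℝ) (hs : ∀ k, ‖s k‖ ≤ h k)
    (huv : ∀ k j : ℕ, j ≤ k → u j * v k ≤ u k * v j)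
    (hu : 0 < ∑ k ∈ range T, h k * u k) (hv : 0 < ∑ k ∈ range T, h k * v k) :
    ‖(∑ k ∈ range T, h k * u k)⁻¹ • ∑ k ∈ range T, u k • s k -
        (∑ k ∈ range T, h k * v k)⁻¹ • ∑ k ∈ range T, v k • s k‖ ≤
      2 * ((∑ k ∈ range T, h k * u k)⁻¹ * ∑ k ∈ range T, u k * (k * h k) -
        (∑ k ∈ range T, h k * v k)⁻¹ * ∑ k ∈ range T, v k * (k * h k)) := by
  have e1 := two_smul_cross_sum s h u v T
  have e2 := two_smul_cross_sum (fun k => (k : ℝ) * h k) h u v T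
  simp only [smul_eq_mul] at e2
  have hh : ∀ k, 0 ≤ h k := fun k => (norm_nonneg _).trans (hs k)
  set U := ∑ k ∈ range T, h k * u k
  set V := ∑ k ∈ range T, h k * v k
  have key : ‖(2 : ℝ) • (V • ∑ k ∈ range T, u k • s k - U • ∑ k ∈ range T, v k • s k)‖ ≤
      2 * (2 * (V * ∑ k ∈ range T, u k * (k * h k) - U * ∑ k ∈ range T, v k * (k * h k))) := by
    rw [e1, e2, mul_sum]
    refine norm_sum_le_of_le _ fun k _ => ?_
    rw [mul_sum]
    refine norm_sum_le_of_le _ fun j _ => ?_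
    rw [norm_smul]
    have b : ‖h j • s k - h k • s j‖ ≤ 2 * (h k * h j) := by
      refine (norm_sub_le _ _).trans ?_
      rw [norm_smul, norm_smul, Real.norm_of_nonneg (hh j), Real.norm_of_nonneg (hh k)]
      have := mul_le_mul_of_nonneg_left (hs k) (hh j)
      have := mul_le_mul_of_nonneg_left (hs j) (hh k)
      linarith
    have hkj := mul_nonneg (hh k) (hh j)
    have c : ‖u k * v j - u j * v k‖ ≤ (u k * v j - u j * v k) * (k - j) := by
      rw [Real.norm_eq_abs]
      rcases lt_trichotomy k j with hlt | rfl | hlt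
      · have h1 := huv j k hlt.le
        have h2 : (k : ℝ) + 1 ≤ j := by exact_mod_cast hlt
        rw [abs_of_nonpos (by linarith)]
        nlinarith
      · simp
      · have h1 := huv k j hlt.le
        have h2 : (j : ℝ) + 1 ≤ k := by exact_mod_cast hlt
        rw [abs_of_nonneg (by linarith)]
        nlinarith
    calc ‖u k * v j - u j * v k‖ * ‖h j • s k - h k • s j‖
        ≤ ((u k * v j - u j * v k) * (k - j)) * (2 * (h k * h j)) :=
          mul_le_mul c b (norm_nonneg _) ((norm_nonneg _).trans c)
      _ = 2 * ((u k * v j - u j * v k) * (h j * (k * h k) - h k * (j * h j))) := by ring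
  rw [norm_smul, Real.norm_of_nonneg zero_le_two] at key
  have key' := le_of_mul_le_mul_left key zero_lt_two
  have eq : U⁻¹ • ∑ k ∈ range T, u k • s k - V⁻¹ • ∑ k ∈ range T, v k • s k =
      (U⁻¹ * V⁻¹) • (V • ∑ k ∈ range T, u k • s k - U • ∑ k ∈ range T, v k • s k) := by
    rw [smul_sub, smul_smul, smul_smul]
    congr 2
    · field_simp
    · field_simp
  rw [eq, norm_smul, Real.norm_of_nonneg (by positivity)]
  refine (mul_le_mul_of_nonneg_left key' (by positivity)).trans (le_of_eq ?_)
  field_simp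

end coupling

/-! ### Equivalence of ensembles -/

section ensembles

variable {ι : Type*} {p : ι → ℝ}

lemma bernPoly_ofReal (s : Finset ι) (p : ι → ℝ) :
    bernPoly s (fun i => (p i : ℂ)) 1 = (bernPoly s p 1).map (algebraMap ℝ ℂ) := by
  simp [bernPoly, Polynomial.map_prod]

lemma zcoeff_bernPoly_ofReal (s : Finset ι) (p : ι → ℝ) (j : ℤ) :
    zcoeff (bernPoly s (fun i => (p i : ℂ)) 1) j = ((zcoeff (bernPoly s p 1) j : ℝ) : ℂ) := by
  rw [bernPoly_ofReal, zcoeff, zcoeff]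
  split_ifs <;> simp

lemma bernPoly_congr {K : Type*} [CommRing K] {s : Finset ι} {p z z' : ι → K}
    (h : ∀ i ∈ s, z i = z' i) : bernPoly s p z = bernPoly s p z' :=
  prod_congr rfl fun i hi => by rw [h i hi]

lemma bernPoly_union_disjoint {K : Type*} [CommRing K] [DecidableEq ι] {s t : Finset ι}
    (h : Disjoint s t) (p z : ι → K) :
    bernPoly (s ∪ t) p z = bernPoly s p z * bernPoly t p z :=
  prod_union h

variable {s t : Finset ι} {z : ι → ℂ}

lemma coeff_bernPoly_twisted_mul {n T : ℕ} (h : n < T) :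
    (bernPoly s (fun i => (p i : ℂ)) z * bernPoly t (fun i => (p i : ℂ)) 1).coeff n =
      ∑ k ∈ range T, zcoeff (bernPoly t p 1) ((n : ℤ) - k) •
        (bernPoly s (fun i => (p i : ℂ)) z).coeff k := by
  rw [coeff_mul_eq_sum_zcoeff _ _ h]
  refine sum_congr rfl fun k _ => ?_
  rw [zcoeff_bernPoly_ofReal, Complex.real_smul, mul_comm]

lemma norm_coeff_bernPoly_le (h0 : ∀ i ∈ s, 0 ≤ p i) (h1 : ∀ i ∈ s, p i ≤ 1)
    (hz : ∀ i ∈ s, ‖z i‖ ≤ 1) (k : ℕ) :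
    ‖(bernPoly s (fun i => (p i : ℂ)) z).coeff k‖ ≤ (bernPoly s p 1).coeff k := by
  simpa using norm_zcoeff_bernPoly_le s h0 h1 z hz k

/-- Equivalence of ensembles for a marginal of a Poisson binomial distribution, with an error that
is controlled by the total variance. -/
theorem norm_canonical_sub_le_sqrt_variance
    (h0 : ∀ i ∈ s, 0 < p i) (h1 : ∀ i ∈ s, p i < 1)
    (k0 : ∀ i ∈ t, 0 < p i) (k1 : ∀ i ∈ t, p i < 1) (hz : ∀ i ∈ s, ‖z i‖ ≤ 1) {n : ℕ}
    (hn : ∑ i ∈ s, p i + ∑ i ∈ t, p i = n) {r : ℝ} (hr : 0 ≤ r)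
    (hder : derivative (bernPoly s p 1) * bernPoly t p 1 =
      C r * derivative (bernPoly s p 1 * bernPoly t p 1)) :
    ‖(bernPoly s (fun i => (p i : ℂ)) z * bernPoly t (fun i => (p i : ℂ)) 1).coeff n /
        ((bernPoly s p 1 * bernPoly t p 1).coeff n : ℂ) -
        (bernPoly s (fun i => (p i : ℂ)) z).eval 1‖ ≤
      2 * r * √(∑ i ∈ s, p i * (1 - p i) + ∑ i ∈ t, p i * (1 - p i)) := by
  classical
  let u : Finset (ι ⊕ ι) := s.disjSum t
  let q : ι ⊕ ι → ℝ := Sum.elim p p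
  have hq : bernPoly u q 1 = bernPoly s p 1 * bernPoly t p 1 := by
    simp [u, q, bernPoly, prod_disjSum]
  have hu0 : ∀ i ∈ u, 0 < q i := by
    rintro (i | i) hi
    · exact h0 i (by simpa [u] using hi)
    · exact k0 i (by simpa [u] using hi)
  have hu1 : ∀ i ∈ u, q i < 1 := by
    rintro (i | i) hi
    · exact h1 i (by simpa [u] using hi)
    · exact k1 i (by simpa [u] using hi)
  have hcard : #u = #s + #t := card_disjSum _ _
  set T := #u + 1 with hT
  have hsum : ∑ i ∈ u, q i = n := by
    rw [← hn]; simp [u, q, sum_disjSum]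
  have hvar : ∑ i ∈ u, q i * (1 - q i) =
      ∑ i ∈ s, p i * (1 - p i) + ∑ i ∈ t, p i * (1 - p i) := by
    simp [u, q, sum_disjSum]
  have hnT : n < T := by
    have : (n : ℝ) ≤ #u := by
      rw [← hsum, card_eq_sum_ones]
      push_cast
      exact sum_le_sum fun i hi => (hu1 i hi).le
    exact Nat.lt_succ_of_le (by exact_mod_cast this)
  set H := bernPoly s p 1 with hH
  set F := bernPoly t p 1 with hF
  set c := bernPoly s (fun i => (p i : ℂ)) z with hc
  have hGpos : ∀ k < T, 0 < (H * F).coeff k := by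
    intro k hk
    rw [← hq]
    exact coeff_bernPoly_pos u hu0 hu1 (by omega)
  set R : ℕ → ℂ := fun k => (((H * F).coeff k)⁻¹ : ℝ) • (c * bernPoly t (fun i => (p i : ℂ)) 1).coeff k
    with hR
  have hmean : ∀ k < T, ((H * F).coeff k)⁻¹ *
      ∑ j ∈ range T, zcoeff F ((k : ℤ) - j) * (j * H.coeff j) = r * k := by
    intro k hk
    have e : ∑ j ∈ range T, zcoeff F ((k : ℤ) - j) * (j * H.coeff j) =
        (X * derivative H * F).coeff k := by
      rw [coeff_mul_eq_sum_zcoeff _ _ hk]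
      refine sum_congr rfl fun j _ => ?_
      rcases j with _ | j
      · simp
      · rw [coeff_X_mul, coeff_derivative]
        push_cast
        ring
    have e2 : (X * derivative H * F).coeff k = r * k * (H * F).coeff k := by
      rw [mul_assoc, hder, mul_left_comm, coeff_C_mul]
      rcases k with _ | k
      · simp
      · rw [coeff_X_mul, coeff_derivative]
        push_cast
        ring
    rw [e, e2]
    have := (hGpos k hk).ne'
    field_simp
  have step : ∀ a b : ℕ, a ≤ b → b < T → ‖R b - R a‖ ≤ 2 * r * |(a : ℝ) - b| := by
    intro a b hab hb
    have ha : a < T := hab.trans_lt hb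
    have := norm_tilted_sub_le (T := T) (h := H.coeff) (fun k => c.coeff k)
      (fun k : ℕ => zcoeff F ((b : ℤ) - k)) (fun k : ℕ => zcoeff F ((a : ℤ) - k))
      (fun k => norm_coeff_bernPoly_le (fun i hi => (h0 i hi).le) (fun i hi => (h1 i hi).le) hz k)
      (by
        intro k j hjk
        rw [mul_comm]
        exact zcoeff_bernPoly_mul_le t (fun i hi => (k0 i hi).le) (fun i hi => (k1 i hi).le)
          _ _ _ _ (by omega) (by omega) (by ring))
      (by rw [← coeff_mul_eq_sum_zcoeff _ _ hb]; exact hGpos b hb)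
      (by rw [← coeff_mul_eq_sum_zcoeff _ _ ha]; exact hGpos a ha)
    simp only [← coeff_mul_eq_sum_zcoeff _ _ hb, ← coeff_mul_eq_sum_zcoeff _ _ ha,
      hmean a ha, hmean b hb] at this
    rw [hc, ← coeff_bernPoly_twisted_mul hb, ← coeff_bernPoly_twisted_mul ha] at this
    refine this.trans (le_of_eq ?_)
    rw [abs_sub_comm, abs_of_nonneg (by simpa using hab)]
    ring
  have step' : ∀ a ∈ range T, ‖R n - R a‖ ≤ 2 * r * |(a : ℝ) - n| := by
    intro a ha
    rw [mem_range] at ha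
    rcases le_total a n with h | h
    · exact step a n h hnT
    · rw [norm_sub_rev, abs_sub_comm]
      exact step n a h ha
  have hsum1 : ∑ k ∈ range T, (H * F).coeff k = 1 := by
    rw [← hq, sum_coeff_eq_eval_one _ (lt_of_le_of_lt (natDegree_bernPoly_le _ _ _) (by omega)),
      eval_one_bernPoly]
  have hC : c.eval 1 = ∑ k ∈ range T, (H * F).coeff k • R k := by
    have e : ∀ k ∈ range T, (H * F).coeff k • R k =
        (c * bernPoly t (fun i => (p i : ℂ)) 1).coeff k := by
      intro k hk
      rw [hR]
      simp only
      rw [smul_smul, mul_inv_cancel₀ (hGpos k (mem_range.1 hk)).ne', one_smul]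
    rw [sum_congr rfl e, sum_coeff_eq_eval_one, eval_mul, eval_one_bernPoly, mul_one]
    have h1 : c.natDegree ≤ #s := natDegree_bernPoly_le s (fun i => (p i : ℂ)) z
    have h2 := natDegree_bernPoly_le t (fun i => (p i : ℂ)) 1
    refine lt_of_le_of_lt natDegree_mul_le ?_
    omega
  have hRn : (c * bernPoly t (fun i => (p i : ℂ)) 1).coeff n / ((H * F).coeff n : ℂ) = R n := by
    simp only [hR, Complex.real_smul, Complex.ofReal_inv]
    rw [div_eq_inv_mul]
  have hdiff : R n - c.eval 1 = ∑ k ∈ range T, (H * F).coeff k • (R n - R k) := by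
    simp only [smul_sub, sum_sub_distrib, ← sum_smul, hsum1, one_smul, hC]
  rw [hRn, hdiff]
  have habs := bernPoly_sum_abs_le (p := q) u (T := T) (by omega) (fun i hi => (hu0 i hi).le)
    (fun i hi => (hu1 i hi).le) hsum
  rw [hvar, hq] at habs
  calc ‖∑ k ∈ range T, (H * F).coeff k • (R n - R k)‖
      ≤ ∑ k ∈ range T, (H * F).coeff k * (2 * r * |(k : ℝ) - n|) := by
        refine norm_sum_le_of_le _ fun k hk => ?_
        have := (hGpos k (mem_range.1 hk)).le
        rw [norm_smul, Real.norm_of_nonneg this]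
        exact mul_le_mul_of_nonneg_left (step' k hk) this
    _ = 2 * r * ∑ k ∈ range T, (H * F).coeff k * |(k : ℝ) - n| := by
        rw [mul_sum]
        exact sum_congr rfl fun k _ => by ring
    _ ≤ _ := mul_le_mul_of_nonneg_left habs (by positivity)

/-- Equivalence of ensembles for a marginal of a Poisson binomial distribution, in terms of the
increments of the distribution of the complement. -/
theorem norm_canonical_sub_le_of_increments
    (h0 : ∀ i ∈ s, 0 ≤ p i) (h1 : ∀ i ∈ s, p i ≤ 1) (hz : ∀ i ∈ s, ‖z i‖ ≤ 1) {n : ℕ}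
    (hG : 0 < (bernPoly s p 1 * bernPoly t p 1).coeff n) {D : ℝ} (hD0 : 0 ≤ D)
    (hD : ∀ j : ℤ, |zcoeff (bernPoly t p 1) (j + 1) - zcoeff (bernPoly t p 1) j| ≤ D) :
    ‖(bernPoly s (fun i => (p i : ℂ)) z * bernPoly t (fun i => (p i : ℂ)) 1).coeff n /
        ((bernPoly s p 1 * bernPoly t p 1).coeff n : ℂ) -
        (bernPoly s (fun i => (p i : ℂ)) z).eval 1‖ ≤
      D * √(2 * ∑ i ∈ s, p i * (1 - p i)) / (bernPoly s p 1 * bernPoly t p 1).coeff n := by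
  set H := bernPoly s p 1 with hH
  set F := bernPoly t p 1 with hF
  set c := bernPoly s (fun i => (p i : ℂ)) z with hc
  set T := max (n + 1) (#s + 1)
  have hnT : n < T := lt_of_lt_of_le n.lt_succ_self (le_max_left _ _)
  have hsT : #s < T := lt_of_lt_of_le (Nat.lt_succ_self _) (le_max_right _ _)
  have hdist : ∀ a b : ℤ, |zcoeff F a - zcoeff F b| ≤ D * |(a : ℝ) - b| := by
    have aux : ∀ (a : ℤ) (k : ℕ), |zcoeff F (a + k) - zcoeff F a| ≤ D * k := by
      intro a k
      induction k with
      | zero => simp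
      | succ k ih =>
        have := hD (a + k)
        push_cast
        rw [← add_assoc]
        have := abs_sub_le (zcoeff F (a + k + 1)) (zcoeff F (a + k)) (zcoeff F a)
        linarith
    intro a b
    rcases le_total a b with h | h
    · have := aux a (b - a).toNat
      rw [Int.toNat_of_nonneg (by omega)] at this
      rw [abs_sub_comm, abs_sub_comm (a : ℝ), abs_of_nonneg (a := (b : ℝ) - a)
        (by rw [sub_nonneg]; exact_mod_cast h)]
      have e : (((b - a).toNat : ℕ) : ℝ) = (b : ℝ) - a := by
        rw [← Int.cast_natCast, Int.toNat_of_nonneg (by omega)]; push_cast; ring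
      rwa [e, add_sub_cancel] at this
    · have := aux b (a - b).toNat
      rw [Int.toNat_of_nonneg (by omega)] at this
      rw [abs_of_nonneg (a := (a : ℝ) - b) (by rw [sub_nonneg]; exact_mod_cast h)]
      have e : (((a - b).toNat : ℕ) : ℝ) = (a : ℝ) - b := by
        rw [← Int.cast_natCast, Int.toNat_of_nonneg (by omega)]; push_cast; ring
      rwa [e, add_sub_cancel] at this
  have hHs : ∑ k ∈ range T, H.coeff k = 1 := by
    rw [sum_coeff_eq_eval_one _ (lt_of_le_of_lt (natDegree_bernPoly_le _ _ _) hsT),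
      eval_one_bernPoly]
  have hcs : ∑ k ∈ range T, c.coeff k = c.eval 1 :=
    sum_coeff_eq_eval_one _ (lt_of_le_of_lt (natDegree_bernPoly_le _ _ _) hsT)
  have hHnn := coeff_bernPoly_nonneg s h0 h1
  set g := (H * F).coeff n with hg
  have hgsum : g = ∑ k ∈ range T, H.coeff k * zcoeff F ((n : ℤ) - k) :=
    coeff_mul_eq_sum_zcoeff _ _ hnT
  have hdev : ∀ k : ℕ, |zcoeff F ((n : ℤ) - k) - g| ≤
      ∑ j ∈ range T, H.coeff j * (D * |(k : ℝ) - j|) := by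
    intro k
    have : zcoeff F ((n : ℤ) - k) - g =
        ∑ j ∈ range T, H.coeff j * (zcoeff F ((n : ℤ) - k) - zcoeff F ((n : ℤ) - j)) := by
      simp only [mul_sub, sum_sub_distrib, ← sum_mul, hHs, one_mul, hgsum]
    rw [this]
    refine (abs_sum_le_sum_abs _ _).trans (sum_le_sum fun j _ => ?_)
    rw [abs_mul, abs_of_nonneg (hHnn j)]
    refine mul_le_mul_of_nonneg_left ((hdist _ _).trans (le_of_eq ?_)) (hHnn j)
    rw [abs_sub_comm]
    push_cast
    congr 2
    ring
  have e : (c * bernPoly t (fun i => (p i : ℂ)) 1).coeff n / (g : ℂ) - c.eval 1 =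
      g⁻¹ • ∑ k ∈ range T, (zcoeff F ((n : ℤ) - k) - g) • c.coeff k := by
    rw [coeff_bernPoly_twisted_mul hnT]
    simp only [sub_smul, sum_sub_distrib, ← smul_sum, hcs]
    rw [smul_sub, smul_smul, inv_mul_cancel₀ hG.ne', one_smul, div_eq_inv_mul, Complex.real_smul,
      Complex.ofReal_inv]
  rw [e, norm_smul, norm_inv, Real.norm_of_nonneg hG.le, div_eq_inv_mul]
  refine mul_le_mul_of_nonneg_left ?_ (inv_nonneg.2 hG.le)
  calc ‖∑ k ∈ range T, (zcoeff F ((n : ℤ) - k) - g) • c.coeff k‖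
      ≤ ∑ k ∈ range T, (∑ j ∈ range T, H.coeff j * (D * |(k : ℝ) - j|)) * H.coeff k := by
        refine norm_sum_le_of_le _ fun k _ => ?_
        rw [norm_smul]
        exact mul_le_mul (hdev k) (norm_coeff_bernPoly_le h0 h1 hz k) (norm_nonneg _)
          ((abs_nonneg _).trans (hdev k))
    _ = D * ∑ k ∈ range T, ∑ j ∈ range T, H.coeff k * H.coeff j * |(k : ℝ) - j| := by
        rw [mul_sum]
        refine sum_congr rfl fun k _ => ?_
        rw [sum_mul, mul_sum]
        exact sum_congr rfl fun j _ => by ring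
    _ ≤ _ := mul_le_mul_of_nonneg_left (bernPoly_sum_abs_sub_le s hsT h0 h1) hD0

end ensembles

/-! ### Local limit estimates -/

section characteristicFunction

variable {ι : Type*} {p : ι → ℝ}

lemma norm_sq_one_sub_add_mul_exp (p φ : ℝ) :
    ‖(1 - p : ℂ) + p * Complex.exp (Complex.I * φ)‖ ^ 2 =
      1 - 4 * (p * (1 - p)) * Real.sin (φ / 2) ^ 2 := by
  have e : (1 - p : ℂ) + p * Complex.exp (Complex.I * φ) =
      ((1 - p + p * Real.cos φ : ℝ) : ℂ) + ((p * Real.sin φ : ℝ) : ℂ) * Complex.I := by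
    rw [mul_comm Complex.I, Complex.exp_mul_I]
    push_cast
    ring
  rw [e, Complex.sq_norm, Complex.normSq_add_mul_I]
  have h1 : Real.cos φ = 1 - 2 * Real.sin (φ / 2) ^ 2 := by
    rw [← Real.cos_sq_add_sin_sq (φ / 2)]
    conv_lhs => rw [show φ = 2 * (φ / 2) by ring, Real.cos_two_mul]
    nlinarith [Real.cos_sq_add_sin_sq (φ / 2)]
  have h2 := Real.sin_sq_add_cos_sq φ
  have h3 : (1 - p + p * Real.cos φ) ^ 2 + (p * Real.sin φ) ^ 2 =
    (1 - p) ^ 2 + 2 * (1 - p) * p * Real.cos φ + p ^ 2 * (Real.sin φ ^ 2 + Real.cos φ ^ 2) := by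
    ring
  rw [h3, h2, h1]
  ring

lemma norm_sq_eval_bernPoly_exp_le (s : Finset ι) (φ : ι → ℝ) :
    ‖(bernPoly s (fun i => (p i : ℂ)) (fun i => Complex.exp (Complex.I * φ i))).eval 1‖ ^ 2 ≤
      Real.exp (-∑ i ∈ s, 4 * (p i * (1 - p i)) * Real.sin (φ i / 2) ^ 2) := by
  rw [bernPoly, eval_prod, norm_prod, ← prod_pow, ← sum_neg_distrib, Real.exp_sum]
  refine prod_le_prod (fun i _ => by positivity) fun i _ => ?_
  have := norm_sq_one_sub_add_mul_exp (p i) (φ i)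
  simp only [eval_add, eval_C, eval_mul, eval_X, mul_one]
  rw [this]
  have := Real.add_one_le_exp (-(4 * (p i * (1 - p i)) * Real.sin (φ i / 2) ^ 2))
  linarith

lemma norm_eval_bernPoly_exp_le (s : Finset ι) (θ : ℝ) :
    ‖(bernPoly s (fun i => (p i : ℂ)) 1).eval (Complex.exp (Complex.I * θ))‖ ≤
      Real.exp (-(2 * (∑ i ∈ s, p i * (1 - p i)) * Real.sin (θ / 2) ^ 2)) := by
  have h := norm_sq_eval_bernPoly_exp_le (p := p) s fun _ => θ
  have e : (bernPoly s (fun i => (p i : ℂ)) 1).eval (Complex.exp (Complex.I * θ)) =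
      (bernPoly s (fun i => (p i : ℂ)) (fun _ => Complex.exp (Complex.I * θ))).eval 1 := by
    simp [bernPoly, eval_prod]
  rw [e]
  refine le_of_sq_le_sq (h.trans (le_of_eq ?_)) (Real.exp_pos _).le
  rw [← Real.exp_nat_mul]
  congr 1
  rw [← sum_mul, ← mul_sum]
  push_cast
  ring

/-- The real part of the characteristic function, centred at `j`. -/
def cosTransform (s : Finset ι) (p : ι → ℝ) (j : ℤ) (θ : ℝ) : ℝ :=
  ∑ k ∈ range (#s + 1), (bernPoly s p 1).coeff k * Real.cos (((k : ℝ) - j) * θ)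

lemma cosTransform_eq_re (s : Finset ι) (j : ℤ) (θ : ℝ) :
    cosTransform s p j θ = ((bernPoly s (fun i => (p i : ℂ)) 1).eval (Complex.exp (Complex.I * θ)) *
      Complex.exp (Complex.I * ((-(j * θ) : ℝ) : ℂ))).re := by
  rw [eval_eq_sum_range' (Nat.lt_succ_of_le (natDegree_bernPoly_le _ _ _)), sum_mul,
    Complex.re_sum, cosTransform]
  refine sum_congr rfl fun k _ => ?_
  rw [bernPoly_ofReal, coeff_map, mul_assoc, ← Complex.exp_nat_mul, ← Complex.exp_add]
  rw [show (k : ℂ) * (Complex.I * θ) + Complex.I * ((-(j * θ) : ℝ) : ℂ) =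
    ((((k : ℝ) - j) * θ : ℝ) : ℂ) * Complex.I by push_cast; ring]
  rw [Complex.coe_algebraMap, Complex.re_ofReal_mul, Complex.exp_ofReal_mul_I_re]

lemma abs_cosTransform_le (s : Finset ι) (j : ℤ) (θ : ℝ) :
    |cosTransform s p j θ| ≤
      Real.exp (-(2 * (∑ i ∈ s, p i * (1 - p i)) * Real.sin (θ / 2) ^ 2)) := by
  rw [cosTransform_eq_re]
  refine (Complex.abs_re_le_norm _).trans ?_
  rw [norm_mul, mul_comm Complex.I (((-(j * θ) : ℝ) : ℂ)), Complex.norm_exp_ofReal_mul_I, mul_one]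
  exact norm_eval_bernPoly_exp_le s θ

lemma abs_cosTransform_sub_le (s : Finset ι) (j : ℤ) {θ : ℝ} (h0 : 0 ≤ θ) (h1 : θ ≤ Real.pi) :
    |cosTransform s p (j + 1) θ - cosTransform s p j θ| ≤ 2 * Real.sin (θ / 2) *
      Real.exp (-(2 * (∑ i ∈ s, p i * (1 - p i)) * Real.sin (θ / 2) ^ 2)) := by
  rw [cosTransform_eq_re, cosTransform_eq_re, ← Complex.sub_re, ← mul_sub]
  refine (Complex.abs_re_le_norm _).trans ?_
  rw [norm_mul, mul_comm]
  refine mul_le_mul ?_ (norm_eval_bernPoly_exp_le s θ) (norm_nonneg _) ?_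
  · have e : Complex.exp (Complex.I * ((-(((j + 1 : ℤ) : ℝ) * θ) : ℝ) : ℂ)) -
        Complex.exp (Complex.I * ((-(j * θ) : ℝ) : ℂ)) =
        Complex.exp (((-(j * θ) : ℝ) : ℂ) * Complex.I) *
          (Complex.exp (Complex.I * ((-θ : ℝ) : ℂ)) - 1) := by
      rw [mul_sub, ← Complex.exp_add]
      push_cast
      ring_nf
    rw [e, norm_mul, Complex.norm_exp_ofReal_mul_I, one_mul, Complex.norm_exp_I_mul_ofReal_sub_one,
      neg_div, Real.sin_neg, norm_mul, norm_neg, Real.norm_of_nonneg zero_le_two,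
      Real.norm_of_nonneg]
    exact Real.sin_nonneg_of_nonneg_of_le_pi (by linarith) (by linarith)
  · have := Real.sin_nonneg_of_nonneg_of_le_pi (x := θ / 2) (by linarith) (by linarith)
    positivity

lemma integral_cos_int_mul (m : ℤ) :
    ∫ θ in (0 : ℝ)..Real.pi, Real.cos (m * θ) = if m = 0 then Real.pi else 0 := by
  split_ifs with h
  · simp [h]
  · have hm : (m : ℝ) ≠ 0 := by exact_mod_cast h
    rw [intervalIntegral.integral_comp_mul_left (fun x => Real.cos x) hm]
    simp [Real.sin_int_mul_pi]

@[fun_prop]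
lemma continuous_cosTransform (s : Finset ι) (j : ℤ) : Continuous (cosTransform s p j) := by
  unfold cosTransform
  fun_prop

lemma zcoeff_eq_integral_cosTransform (s : Finset ι) (j : ℤ) :
    zcoeff (bernPoly s p 1) j = Real.pi⁻¹ * ∫ θ in (0 : ℝ)..Real.pi, cosTransform s p j θ := by
  unfold cosTransform
  rw [intervalIntegral.integral_finsetSum
    (fun k _ => Continuous.intervalIntegrable (by fun_prop) _ _)]
  have e : ∀ k : ℕ, ∫ θ in (0 : ℝ)..Real.pi,
      (bernPoly s p 1).coeff k * Real.cos (((k : ℝ) - j) * θ) =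
      if (k : ℤ) = j then (bernPoly s p 1).coeff k * Real.pi else 0 := by
    intro k
    have := integral_cos_int_mul ((k : ℤ) - j)
    push_cast at this
    rw [intervalIntegral.integral_const_mul, this]
    simp only [sub_eq_zero, mul_ite, mul_zero]
  simp only [e]
  rcases lt_or_ge j 0 with h | h
  · rw [zcoeff_neg _ h, sum_eq_zero, mul_zero]
    intro k _
    rw [if_neg (by omega)]
  · lift j to ℕ using h
    simp only [Nat.cast_inj, sum_ite_eq', mem_range, zcoeff_natCast]
    split_ifs with hj
    · field_simp
    · rw [coeff_eq_zero_of_natDegree_lt, mul_zero]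
      exact lt_of_le_of_lt (natDegree_bernPoly_le _ _ _) (by omega)

lemma exp_neg_two_mul_sin_sq_le {V t : ℝ} (hV : 0 ≤ V) (hc : 0 ≤ Real.cos t) :
    Real.exp (-(2 * V * Real.sin t ^ 2)) ≤
      Real.exp (-(3 * V * (1 - Real.cos t))) + Real.exp (-(3 / 2 * V)) := by
  have h1 := Real.cos_le_one t
  have h2 := Real.sin_sq t
  rcases le_total (Real.cos t) (1 / 2) with h | h
  · refine le_add_of_nonneg_of_le (Real.exp_pos _).le (Real.exp_le_exp.2 ?_)
    have : 3 / 4 ≤ Real.sin t ^ 2 := by nlinarith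
    nlinarith
  · refine le_add_of_le_of_nonneg (Real.exp_le_exp.2 ?_) (Real.exp_pos _).le
    have : 3 / 2 * (1 - Real.cos t) ≤ Real.sin t ^ 2 := by nlinarith
    nlinarith

lemma exp_neg_le_two_div_sq {x : ℝ} (hx : 0 < x) : Real.exp (-x) ≤ 2 / x ^ 2 := by
  rw [Real.exp_neg, ← one_div, div_le_div_iff₀ (Real.exp_pos x) (by positivity)]
  have := Real.quadratic_le_exp_of_nonneg hx.le
  nlinarith

/-- The increments of a Poisson binomial distribution of variance `V` are at most of order
`1 / V`. -/
theorem abs_zcoeff_bernPoly_succ_sub_le (s : Finset ι) {V : ℝ}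
    (hV : ∑ i ∈ s, p i * (1 - p i) = V) (hV60 : 60 ≤ V) (j : ℤ) :
    |zcoeff (bernPoly s p 1) (j + 1) - zcoeff (bernPoly s p 1) j| ≤ 0.4434 / V := by
  have hV0 : 0 < V := by linarith
  have hpi := Real.pi_pos
  have key : |∫ θ in (0 : ℝ)..Real.pi, (cosTransform s p (j + 1) θ - cosTransform s p j θ)| ≤
      4 / (3 * V) + 4 * Real.exp (-(3 / 2 * V)) := by
    have hle : ∀ θ ∈ Set.Icc 0 Real.pi, ‖cosTransform s p (j + 1) θ - cosTransform s p j θ‖ ≤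
        2 * Real.sin (θ / 2) * (Real.exp (-(3 * V * (1 - Real.cos (θ / 2)))) +
          Real.exp (-(3 / 2 * V))) := by
      intro θ hθ
      refine (abs_cosTransform_sub_le s j hθ.1 hθ.2).trans ?_
      rw [hV]
      refine mul_le_mul_of_nonneg_left (exp_neg_two_mul_sin_sq_le hV0.le ?_) ?_
      · exact Real.cos_nonneg_of_neg_pi_div_two_le_of_le (by linarith [hθ.1]) (by linarith [hθ.2])
      · have := Real.sin_nonneg_of_nonneg_of_le_pi (x := θ / 2) (by linarith [hθ.1])
          (by linarith [hθ.2])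
        positivity
    have hint : ∫ θ in (0 : ℝ)..Real.pi, 2 * Real.sin (θ / 2) *
        (Real.exp (-(3 * V * (1 - Real.cos (θ / 2)))) + Real.exp (-(3 / 2 * V))) =
        4 / (3 * V) * (1 - Real.exp (-(3 * V))) + 4 * Real.exp (-(3 / 2 * V)) := by
      have hd : ∀ θ ∈ Set.uIcc 0 Real.pi, HasDerivAt
          (fun θ => -(4 / (3 * V)) * Real.exp (-(3 * V * (1 - Real.cos (θ / 2)))) -
            4 * Real.cos (θ / 2) * Real.exp (-(3 / 2 * V)))
          (2 * Real.sin (θ / 2) * (Real.exp (-(3 * V * (1 - Real.cos (θ / 2)))) +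
            Real.exp (-(3 / 2 * V)))) θ := by
        intro θ _
        have h1 : HasDerivAt (fun θ : ℝ => Real.cos (θ / 2)) (-Real.sin (θ / 2) * (1 / 2)) θ :=
          (Real.hasDerivAt_cos _).comp θ ((hasDerivAt_id θ).div_const 2)
        have h2 := ((((h1.const_sub 1).const_mul (3 * V)).fun_neg).exp).const_mul (-(4 / (3 * V)))
        have h3 := (h1.const_mul 4).mul_const (Real.exp (-(3 / 2 * V)))
        refine HasDerivAt.congr_deriv (h2.sub h3) ?_
        field_simp
        ring
      rw [intervalIntegral.integral_eq_sub_of_hasDerivAt hd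
        (Continuous.intervalIntegrable (by fun_prop) _ _)]
      simp
      ring
    calc |∫ θ in (0 : ℝ)..Real.pi, (cosTransform s p (j + 1) θ - cosTransform s p j θ)|
        ≤ ∫ θ in (0 : ℝ)..Real.pi, ‖cosTransform s p (j + 1) θ - cosTransform s p j θ‖ :=
          intervalIntegral.abs_integral_le_integral_abs hpi.le
      _ ≤ _ := intervalIntegral.integral_mono_on hpi.le
          (Continuous.intervalIntegrable (by fun_prop) _ _)
          (Continuous.intervalIntegrable (by fun_prop) _ _) hle
      _ ≤ _ := by
        rw [hint]
        have : 0 ≤ 4 / (3 * V) * Real.exp (-(3 * V)) := by positivity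
        linarith
  rw [zcoeff_eq_integral_cosTransform, zcoeff_eq_integral_cosTransform, ← mul_sub,
    ← intervalIntegral.integral_sub (Continuous.intervalIntegrable (by fun_prop) _ _)
      (Continuous.intervalIntegrable (by fun_prop) _ _), abs_mul, abs_of_pos (inv_pos.2 hpi),
    inv_mul_le_iff₀ hpi]
  refine key.trans ?_
  have h1 := exp_neg_le_two_div_sq (x := 3 / 2 * V) (by linarith)
  have h2 : 2 / (3 / 2 * V) ^ 2 ≤ 0.0149 / V := by
    rw [div_le_div_iff₀ (by positivity) hV0]
    nlinarith
  have h3 : 4 / (3 * V) = (4 / 3) / V := by field_simp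
  rw [h3]
  calc 4 / 3 / V + 4 * Real.exp (-(3 / 2 * V)) ≤ 4 / 3 / V + 4 * (0.0149 / V) := by linarith
    _ = (4 / 3 + 4 * 0.0149) / V := by ring
    _ ≤ (3.1415 * 0.4434) / V := by gcongr; norm_num
    _ ≤ (Real.pi * 0.4434) / V := by gcongr; exact Real.pi_gt_d4.le
    _ = Real.pi * (0.4434 / V) := by ring

lemma exp_neg_two_mul_sin_half_sq_le {V θ : ℝ} (hV : 0 ≤ V) (h0 : 0 ≤ θ) (h1 : θ ≤ Real.pi) :
    Real.exp (-(2 * V * Real.sin (θ / 2) ^ 2)) ≤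
      Real.exp (-(0.439 * V * θ ^ 2)) + Real.exp (-(0.439 * V)) := by
  rcases le_total θ 1 with h | h
  · refine le_add_of_le_of_nonneg (Real.exp_le_exp.2 ?_) (Real.exp_pos _).le
    rcases h0.eq_or_lt with rfl | h0
    · simp
    have hs := Real.sin_gt_sub_cube (x := θ / 2) (by linarith)
    have hs2 : 0.9375 * (θ / 2) ≤ Real.sin (θ / 2) := by
      refine le_trans ?_ hs.le
      have : 0 ≤ (θ / 2) * (1 - θ ^ 2) := mul_nonneg (by linarith) (by nlinarith)
      nlinarith
    have : (0.9375 * (θ / 2)) ^ 2 ≤ Real.sin (θ / 2) ^ 2 := by gcongr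
    have : 0.439 / 2 * θ ^ 2 ≤ Real.sin (θ / 2) ^ 2 := by nlinarith
    nlinarith
  · refine le_add_of_nonneg_of_le (Real.exp_pos _).le (Real.exp_le_exp.2 ?_)
    have hs := Real.sin_gt_sub_cube (x := 1 / 2) (by norm_num)
    have hm : Real.sin (1 / 2) ≤ Real.sin (θ / 2) :=
      Real.sin_le_sin_of_le_of_le_pi_div_two (by linarith [Real.pi_gt_three]) (by linarith)
        (by linarith)
    have h2 : 0.46875 ≤ Real.sin (θ / 2) := by norm_num at hs ⊢; linarith
    have : 0.439 / 2 ≤ Real.sin (θ / 2) ^ 2 := by nlinarith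
    nlinarith

/-- A Poisson binomial distribution of integer mean `n` and large variance `V` is at least of
order `1 / √V` at `n`. -/
theorem le_coeff_bernPoly_mean (s : Finset ι) (h0 : ∀ i ∈ s, 0 ≤ p i) (h1 : ∀ i ∈ s, p i ≤ 1)
    {n : ℕ} (hn : ∑ i ∈ s, p i = n) {V : ℝ}
    (hV : ∑ i ∈ s, p i * (1 - p i) = V) (hV64 : 64 ≤ V) :
    0.19 / √V ≤ (bernPoly s p 1).coeff n := by
  have hV0 : 0 < V := by linarith
  have hpi := Real.pi_pos
  have hpi3 := Real.pi_gt_three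
  set v := √V with hv
  have hv8 : 8 ≤ v := Real.le_sqrt_of_sq_le (by norm_num; exact hV64)
  have hv0 : 0 < v := by linarith
  have hvV : v ^ 2 = V := Real.sq_sqrt hV0.le
  set T := 1.6 / v with hT
  have hT0 : 0 < T := by positivity
  have hTv : T * v = 1.6 := by rw [hT]; field_simp
  have hTpi : T ≤ Real.pi := by
    have : T ≤ 1.6 / 8 := by rw [hT]; gcongr
    linarith
  have hI1 : ∫ θ in (0 : ℝ)..T, (1 - V / 2 * θ ^ 2) ≤
      ∫ θ in (0 : ℝ)..T, cosTransform s p n θ := by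
    refine intervalIntegral.integral_mono_on hT0.le
      (Continuous.intervalIntegrable (by fun_prop) _ _)
      (Continuous.intervalIntegrable (by fun_prop) _ _) fun θ _ => ?_
    have h2 := bernPoly_second_moment (p := p) s (Nat.lt_succ_self _) n
    have hs := sum_coeff_eq_eval_one (bernPoly s p 1)
      (Nat.lt_succ_of_le (natDegree_bernPoly_le s p 1))
    rw [eval_one_bernPoly] at hs
    rw [hn, sub_self, zero_pow two_ne_zero, add_zero, hV] at h2
    have e : 1 - V / 2 * θ ^ 2 = ∑ k ∈ range (#s + 1), (bernPoly s p 1).coeff k *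
        (1 - (((k : ℝ) - n) * θ) ^ 2 / 2) := by
      rw [← h2]
      nth_rewrite 1 [← hs]
      rw [sum_div, sum_mul, ← sum_sub_distrib]
      exact sum_congr rfl fun k _ => by ring
    rw [e, cosTransform]
    exact sum_le_sum fun k _ => mul_le_mul_of_nonneg_left
      (by simpa using Real.one_sub_sq_div_two_le_cos (x := ((k : ℝ) - n) * θ))
      (coeff_bernPoly_nonneg s h0 h1 k)
  have hI1' : ∫ θ in (0 : ℝ)..T, (1 - V / 2 * θ ^ 2) = T - V * T ^ 3 / 6 := by
    rw [intervalIntegral.integral_sub (Continuous.intervalIntegrable (by fun_prop) _ _)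
      (Continuous.intervalIntegrable (by fun_prop) _ _), intervalIntegral.integral_const_mul,
      integral_pow]
    simp
    ring
  have hI2 : -(∫ θ in T..Real.pi, (Real.exp (-(0.439 * V * (2 * T * θ - T ^ 2))) +
      Real.exp (-(0.439 * V)))) ≤ ∫ θ in T..Real.pi, cosTransform s p n θ := by
    rw [← intervalIntegral.integral_neg]
    refine intervalIntegral.integral_mono_on hTpi
      (Continuous.intervalIntegrable (by fun_prop) _ _)
      (Continuous.intervalIntegrable (by fun_prop) _ _) fun θ hθ => ?_
    have h3 := neg_le_of_abs_le (abs_cosTransform_le (p := p) s n θ)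
    rw [hV] at h3
    have h4 := exp_neg_two_mul_sin_half_sq_le hV0.le (hT0.le.trans hθ.1) hθ.2
    have h5 : Real.exp (-(0.439 * V * θ ^ 2)) ≤ Real.exp (-(0.439 * V * (2 * T * θ - T ^ 2))) := by
      refine Real.exp_le_exp.2 (neg_le_neg ?_)
      have : 2 * T * θ - T ^ 2 ≤ θ ^ 2 := by nlinarith [sq_nonneg (θ - T)]
      gcongr
    linarith
  have hI2' : ∫ θ in T..Real.pi, (Real.exp (-(0.439 * V * (2 * T * θ - T ^ 2))) +
      Real.exp (-(0.439 * V))) ≤ Real.exp (-(0.439 * V * T ^ 2)) / (2 * 0.439 * V * T) +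
        Real.pi * Real.exp (-(0.439 * V)) := by
    have hd : ∀ θ ∈ Set.uIcc T Real.pi, HasDerivAt
        (fun θ => -(1 / (2 * 0.439 * V * T)) * Real.exp (-(0.439 * V * (2 * T * θ - T ^ 2))) +
          θ * Real.exp (-(0.439 * V)))
        (Real.exp (-(0.439 * V * (2 * T * θ - T ^ 2))) + Real.exp (-(0.439 * V))) θ := by
      intro θ _
      have h1 := ((hasDerivAt_id θ).const_mul (2 * T)).sub_const (T ^ 2)
      have h2 := (((h1.const_mul (0.439 * V)).fun_neg).exp).const_mul (-(1 / (2 * 0.439 * V * T)))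
      have h3 := (hasDerivAt_id θ).mul_const (Real.exp (-(0.439 * V)))
      refine HasDerivAt.congr_deriv (h2.add h3) ?_
      simp only [id]
      field_simp
    rw [intervalIntegral.integral_eq_sub_of_hasDerivAt hd
      (Continuous.intervalIntegrable (by fun_prop) _ _)]
    have e : 2 * T * T - T ^ 2 = T ^ 2 := by ring
    rw [e]
    have a1 : 0 ≤ 1 / (2 * 0.439 * V * T) * Real.exp (-(0.439 * V * (2 * T * Real.pi - T ^ 2))) := by
      positivity
    have a2 : 0 ≤ T * Real.exp (-(0.439 * V)) := by positivity
    have a3 : Real.exp (-(0.439 * V * T ^ 2)) / (2 * 0.439 * V * T) =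
      1 / (2 * 0.439 * V * T) * Real.exp (-(0.439 * V * T ^ 2)) := by ring
    rw [a3]
    linarith
  have hVT : V * T ^ 2 = 2.56 := by
    rw [← hvV, ← mul_pow, mul_comm, hTv]; norm_num
  have hVT' : V * T = 1.6 * v := by rw [← hvV]; nlinarith
  have b1 : Real.exp (-(0.439 * V * T ^ 2)) / (2 * 0.439 * V * T) ≤ 0.236 / v := by
    have e1 : 0.439 * V * T ^ 2 = 0.439 * 2.56 := by rw [mul_assoc, hVT]
    have e2 : 2 * 0.439 * V * T = 2 * 0.439 * 1.6 * v := by rw [mul_assoc, hVT']; ring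
    rw [e1, e2]
    have e3 : Real.exp (-(0.439 * 2.56)) ≤ 0.33 := by
      rw [Real.exp_neg, inv_le_comm₀ (Real.exp_pos _) (by norm_num)]
      have h1 := Real.exp_one_gt_d9
      have h2 := Real.add_one_le_exp (0.12 : ℝ)
      have h3 : Real.exp 1 * Real.exp 0.12 ≤ Real.exp (0.439 * 2.56) := by
        rw [← Real.exp_add]
        exact Real.exp_le_exp.2 (by norm_num)
      refine le_trans ?_ h3
      nlinarith
    rw [div_le_div_iff₀ (by positivity) hv0]
    nlinarith
  have b2 : Real.pi * Real.exp (-(0.439 * V)) ≤ 0.064 / v := by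
    have h1 := exp_neg_le_two_div_sq (x := 0.439 * V) (by positivity)
    have h2 : 2 / (0.439 * V) ^ 2 ≤ 0.0203 / v := by
      rw [div_le_div_iff₀ (by positivity) hv0, ← hvV]
      have h512 : (512 : ℝ) ≤ v ^ 3 := by
        calc (512 : ℝ) = 8 ^ 3 := by norm_num
          _ ≤ v ^ 3 := by gcongr
      nlinarith
    have h3 := Real.pi_lt_d4
    calc Real.pi * Real.exp (-(0.439 * V)) ≤ 3.1416 * (0.0203 / v) := by gcongr; linarith
      _ = (3.1416 * 0.0203) / v := by ring
      _ ≤ _ := by gcongr; norm_num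
  have b3 : T - V * T ^ 3 / 6 = (1.6 - 1.6 * 2.56 / 6) / v := by
    have : V * T ^ 3 = 2.56 * T := by rw [← hVT]; ring
    rw [this, hT]
    ring
  rw [← zcoeff_natCast, zcoeff_eq_integral_cosTransform, inv_mul_eq_div, le_div_iff₀ hpi,
    ← intervalIntegral.integral_add_adjacent_intervals (b := T)
      (Continuous.intervalIntegrable (by fun_prop) _ _)
      (Continuous.intervalIntegrable (by fun_prop) _ _)]
  rw [hI1', b3] at hI1
  have fin : 0.19 / v * Real.pi ≤ (1.6 - 1.6 * 2.56 / 6) / v - 0.236 / v - 0.064 / v := by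
    have h3 := Real.pi_lt_d4
    rw [← sub_div, ← sub_div, div_mul_eq_mul_div]
    gcongr
    nlinarith
  linarith

end characteristicFunction

/-! ### Expectations as coefficients of generating polynomials -/

section configurations

lemma particleNumber_le {Λ : Finset Site} (α : Config Λ) : particleNumber α ≤ #Λ := by
  unfold particleNumber
  refine (sum_le_sum (g := fun _ => 1) fun x _ => ?_).trans (by simp)
  omega

lemma prod_one_add_mul_X (Λ : Finset Site) (u : Site → ℂ) :
    ∏ x ∈ Λ, (1 + C (u x) * X) =
      ∑ α : Config Λ, C (∏ x : Λ, u x ^ (α x : ℕ)) * X ^ particleNumber α := by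
  rw [← prod_coe_sort Λ (fun x => 1 + C (u x) * X)]
  have e : ∀ x : Λ, 1 + C (u x) * X = ∑ a : Fin 2, (C (u x) * X) ^ (a : ℕ) := by
    intro x
    simp [Fin.sum_univ_two]
  simp only [e]
  rw [Fintype.prod_sum]
  refine sum_congr rfl fun α _ => ?_
  simp only [mul_pow, prod_mul_distrib, particleNumber, map_prod, map_pow, prod_pow_eq_pow_sum]

variable {Λ : Finset Site} {w : Site → ℝ} (hw : ∀ x, 0 < w x)
include hw

lemma prod_one_add_mul_X_eq_bernPoly (z : Site → ℂ) :
    ∏ x ∈ Λ, (1 + C ((w x : ℂ) * z x) * X) =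
      C ((∏ x ∈ Λ, (1 + w x) : ℝ) : ℂ) *
        bernPoly Λ (fun x => ((w x / (1 + w x) : ℝ) : ℂ)) z := by
  rw [bernPoly, Complex.ofReal_prod, map_prod, ← prod_mul_distrib]
  refine prod_congr rfl fun x _ => ?_
  have h : (1 + (w x : ℂ)) ≠ 0 := by
    have := hw x
    exact_mod_cast (show (1 + w x) ≠ 0 by positivity)
  rw [mul_add, ← C_mul, ← mul_assoc, ← C_mul, ← C_1]
  push_cast
  congr 3
  · field_simp
    ring
  · field_simp

lemma sum_config_of_particleNumber (z : Site → ℂ) (n : ℕ) :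
    ∑ α : Config Λ, (if particleNumber α = n then ∏ x : Λ, ((w x : ℂ) * z x) ^ (α x : ℕ) else 0) =
      ((∏ x ∈ Λ, (1 + w x) : ℝ) : ℂ) *
        (bernPoly Λ (fun x => ((w x / (1 + w x) : ℝ) : ℂ)) z).coeff n := by
  rw [← coeff_C_mul, ← prod_one_add_mul_X_eq_bernPoly hw,
    prod_one_add_mul_X Λ (fun x => (w x : ℂ) * z x), finsetSum_coeff]
  refine sum_congr rfl fun α _ => ?_
  rw [coeff_C_mul, coeff_X_pow]
  simp [eq_comm]

lemma sum_config (z : Site → ℂ) (g : ℕ → ℂ) :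
    ∑ α : Config Λ, g (particleNumber α) * ∏ x : Λ, ((w x : ℂ) * z x) ^ (α x : ℕ) =
      ((∏ x ∈ Λ, (1 + w x) : ℝ) : ℂ) * ∑ k ∈ range (#Λ + 1),
        (bernPoly Λ (fun x => ((w x / (1 + w x) : ℝ) : ℂ)) z).coeff k * g k := by
  rw [mul_sum]
  simp only [← mul_assoc, ← sum_config_of_particleNumber hw, sum_mul]
  rw [sum_comm]
  refine sum_congr rfl fun α _ => ?_
  simp only [ite_mul, zero_mul]
  rw [sum_ite_eq, if_pos (mem_range.2 (Nat.lt_succ_of_le (particleNumber_le α))), mul_comm]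

end configurations

/-- The grand canonical weight of a particle at `x`. -/
def gcWeight (q μ : ℝ) (x : Site) : ℝ := q ^ (2 * ((level x : ℝ) - μ))

/-- The grand canonical occupation probability of a site at the level `l`. -/
def levelProb (q μ : ℝ) (l : ℤ) : ℝ := q ^ (2 * ((l : ℝ) - μ)) / (1 + q ^ (2 * ((l : ℝ) - μ)))

/-- The phase factors of `phaseOp`. -/
def phaseFactor (φ : Site → ℝ) (x : Site) : ℂ := Complex.exp (Complex.I * φ x)

section expectations

variable {q : ℝ} (hq0 : 0 < q) {Λ : Finset Site} {μ : ℝ}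
include hq0

lemma gcWeight_pos (μ : ℝ) (x : Site) : 0 < gcWeight q μ x := Real.rpow_pos_of_pos hq0 _

lemma levelProb_pos (μ : ℝ) (l : ℤ) : 0 < levelProb q μ l := by
  unfold levelProb
  positivity

lemma levelProb_lt_one (μ : ℝ) (l : ℤ) : levelProb q μ l < 1 := by
  unfold levelProb
  rw [div_lt_one (by positivity)]
  linarith

lemma inner_gcState_diagonalOp (d : Config Λ → ℂ) :
    inner ℂ (gcState q Λ μ) (diagonalOp d (gcState q Λ μ)) =
      ∑ α : Config Λ, d α * ∏ x : Λ, (gcWeight q μ x : ℂ) ^ (α x : ℕ) := by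
  rw [PiLp.inner_apply]
  refine sum_congr rfl fun α _ => ?_
  simp only [diagonalOp, gcState, LinearMap.coe_mk, AddHom.coe_mk, RCLike.inner_apply, map_prod,
    Complex.conj_ofReal]
  rw [mul_assoc, ← prod_mul_distrib]
  congr 1
  refine prod_congr rfl fun x _ => ?_
  rw [gcWeight, ← Complex.ofReal_mul, ← Complex.ofReal_pow, ← Real.rpow_add hq0,
    ← Real.rpow_mul_natCast hq0.le]
  congr 2
  ring

lemma inner_gcState_self :
    inner ℂ (gcState q Λ μ) (gcState q Λ μ) = ((∏ x ∈ Λ, (1 + gcWeight q μ x) : ℝ) : ℂ) := by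
  have h := inner_gcState_diagonalOp hq0 (Λ := Λ) (μ := μ) (fun _ => 1)
  have e : diagonalOp (fun _ => 1) (gcState q Λ μ) = gcState q Λ μ := by
    ext α
    simp [diagonalOp]
  rw [e] at h
  rw [h]
  have h2 := sum_config (gcWeight_pos hq0 μ) (Λ := Λ) 1 (fun _ => 1)
  simp only [Pi.one_apply, mul_one] at h2
  rw [h2, sum_coeff_eq_eval_one _ (Nat.lt_succ_of_le (natDegree_bernPoly_le _ _ _)),
    eval_one_bernPoly, mul_one]

lemma prod_one_add_gcWeight_ne_zero :
    ((∏ x ∈ Λ, (1 + gcWeight q μ x) : ℝ) : ℂ) ≠ 0 := by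
  have : 0 < ∏ x ∈ Λ, (1 + gcWeight q μ x) :=
    prod_pos fun x _ => by have := gcWeight_pos hq0 μ x; positivity
  exact_mod_cast this.ne'

lemma gcExpectation_phaseOp (φ : Site → ℝ) :
    gcExpectation q Λ μ (phaseOp Λ φ) =
      (bernPoly Λ (fun x => (levelProb q μ (level x) : ℂ)) (phaseFactor φ)).eval 1 := by
  rw [gcExpectation, phaseOp, inner_gcState_diagonalOp hq0, inner_gcState_self hq0,
    div_eq_iff (prod_one_add_gcWeight_ne_zero hq0), mul_comm,
    ← sum_coeff_eq_eval_one _ (Nat.lt_succ_of_le (natDegree_bernPoly_le _ _ _))]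
  have h2 := sum_config (gcWeight_pos hq0 μ) (Λ := Λ) (phaseFactor φ) (fun _ => 1)
  simp only [mul_one, one_mul] at h2
  refine Eq.trans ?_ h2
  refine sum_congr rfl fun α _ => ?_
  rw [← prod_mul_distrib]
  refine prod_congr rfl fun x _ => ?_
  rw [mul_pow, mul_comm]
  congr 1
  rcases (show α x = 0 ∨ α x = 1 by omega) with h | h <;> simp [h, phaseFactor]

lemma gcExpectation_numberOp :
    gcExpectation q Λ μ (numberOp Λ) = ((∑ x ∈ Λ, levelProb q μ (level x) : ℝ) : ℂ) := by
  rw [gcExpectation, numberOp, inner_gcState_diagonalOp hq0, inner_gcState_self hq0,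
    div_eq_iff (prod_one_add_gcWeight_ne_zero hq0), mul_comm]
  have h2 := sum_config (gcWeight_pos hq0 μ) (Λ := Λ) 1 (fun k => k)
  simp only [Pi.one_apply, mul_one] at h2
  rw [h2]
  congr 1
  have h3 := bernPoly_first_moment (p := fun x => levelProb q μ (level x)) Λ (Nat.lt_succ_self _) 0
  simp only [sub_zero] at h3
  rw [← h3, Complex.ofReal_sum]
  refine sum_congr rfl fun k _ => ?_
  have h4 := zcoeff_bernPoly_ofReal Λ (fun x => levelProb q μ (level x)) k
  rw [zcoeff_natCast, zcoeff_natCast] at h4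
  rw [Complex.ofReal_mul, ← h4]
  rfl

lemma inner_groundState_perturbedState (n : ℕ) (φ : Site → ℝ) (μ : ℝ) :
    inner ℂ (groundState q Λ n) (perturbedState q Λ n φ) =
      ((q ^ (2 * μ * n) * ∏ x ∈ Λ, (1 + gcWeight q μ x) : ℝ) : ℂ) *
        (bernPoly Λ (fun x => (levelProb q μ (level x) : ℂ)) (phaseFactor φ)).coeff n := by
  rw [Complex.ofReal_mul, mul_assoc]
  refine Eq.trans ?_ (congrArg _
    (sum_config_of_particleNumber (gcWeight_pos hq0 μ) (Λ := Λ) (phaseFactor φ) n))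
  rw [PiLp.inner_apply, mul_sum]
  refine sum_congr rfl fun α _ => ?_
  simp only [groundState, perturbedState, RCLike.inner_apply]
  split_ifs with hα
  swap
  · simp
  have e : ((q ^ (2 * μ * n) : ℝ) : ℂ) = ∏ x : Λ, ((q ^ (2 * μ * (α x : ℕ)) : ℝ) : ℂ) := by
    rw [← Complex.ofReal_prod, ← Real.rpow_sum_of_pos hq0, ← mul_sum, ← hα, particleNumber]
    push_cast
    rfl
  rw [e, map_prod, ← prod_mul_distrib, ← prod_mul_distrib]
  refine prod_congr rfl fun x _ => ?_
  rw [Complex.conj_ofReal, mul_pow, phaseFactor, ← Complex.exp_nat_mul, gcWeight,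
    ← Complex.ofReal_pow, ← Real.rpow_mul_natCast hq0.le, mul_assoc, ← Complex.ofReal_mul,
    ← mul_assoc, ← Complex.ofReal_mul, ← Real.rpow_add hq0, mul_comm]
  congr 1
  · rw [← Real.rpow_intCast, ← Real.rpow_add hq0]
    congr 2
    push_cast
    ring
  · congr 1
    ring

lemma inner_groundState_self (n : ℕ) (μ : ℝ) :
    inner ℂ (groundState q Λ n) (groundState q Λ n) =
      ((q ^ (2 * μ * n) * ∏ x ∈ Λ, (1 + gcWeight q μ x) : ℝ) : ℂ) *
        (bernPoly Λ (fun x => levelProb q μ (level x)) 1).coeff n := by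
  have e : perturbedState q Λ n 0 = groundState q Λ n := by
    simp [perturbedState, groundState]
  have h := inner_groundState_perturbedState hq0 (Λ := Λ) n 0 μ
  have e2 : phaseFactor 0 = 1 := by
    ext x
    simp [phaseFactor]
  have h4 := zcoeff_bernPoly_ofReal Λ (fun x => levelProb q μ (level x)) n
  rw [zcoeff_natCast, zcoeff_natCast] at h4
  rw [e, e2, h4] at h
  exact h

lemma inner_groundState_perturbedState_div (n : ℕ) (φ : Site → ℝ) (μ : ℝ) :
    inner ℂ (groundState q Λ n) (perturbedState q Λ n φ) /
        inner ℂ (groundState q Λ n) (groundState q Λ n) =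
      (bernPoly Λ (fun x => (levelProb q μ (level x) : ℂ)) (phaseFactor φ)).coeff n /
        ((bernPoly Λ (fun x => levelProb q μ (level x)) 1).coeff n : ℂ) := by
  rw [inner_groundState_perturbedState hq0 n φ μ, inner_groundState_self hq0 n μ,
    mul_div_mul_left]
  rw [Complex.ofReal_mul]
  refine mul_ne_zero ?_ (prod_one_add_gcWeight_ne_zero hq0)
  exact_mod_cast (Real.rpow_pos_of_pos hq0 _).ne'

end expectations

section cylinders

lemma level_add (x y : Site) : level (x + y) = level x + level y := by
  simp only [level, Pi.add_apply]
  ring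

lemma level_stickSite (l : ℤ) : level (stickSite l) = l := by
  simp only [level, stickSite, Matrix.cons_val_zero, Matrix.cons_val_one, Matrix.cons_val]
  omega

/-- The levels of the sites of a stick. -/
abbrev stickLevels (L : ℕ) : Finset ℤ := Finset.Icc (-((L : ℤ) / 2)) ((L : ℤ) / 2)

lemma card_stickLevels {L : ℕ} (hL : Even L) : #(stickLevels L) = L + 1 := by
  obtain ⟨k, rfl⟩ := hL
  rw [Int.card_Icc]
  omega

lemma injective_stickSite : Function.Injective stickSite := fun a b h => by
  rw [← level_stickSite a, h, level_stickSite]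

lemma cylinder_eq_image {Γ : Finset Site} (L : ℕ) :
    cylinder Γ L = (Γ ×ˢ stickLevels L).image fun y => y.1 + stickSite y.2 := by
  ext x
  simp only [cylinder, stick, mem_image₂, mem_image, mem_product, Prod.exists]
  constructor
  · rintro ⟨a, ha, _, ⟨l, hl, rfl⟩, rfl⟩
    exact ⟨a, l, ⟨ha, hl⟩, rfl⟩
  · rintro ⟨a, l, ⟨ha, hl⟩, rfl⟩
    exact ⟨a, ha, _, ⟨l, hl, rfl⟩, rfl⟩

variable {Γ : Finset Site} (hΓ : ∀ x ∈ Γ, level x = 0)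
include hΓ

lemma injOn_add_stickSite (L : ℕ) :
    Set.InjOn (fun y : Site × ℤ => y.1 + stickSite y.2) (Γ ×ˢ stickLevels L : Finset _) := by
  rintro ⟨a, l⟩ h ⟨a', l'⟩ h' (e : a + stickSite l = a' + stickSite l')
  simp only [coe_product, Set.mem_prod, mem_coe] at h h'
  have : level (a + stickSite l) = level (a' + stickSite l') := by rw [e]
  rw [level_add, level_add, hΓ a h.1, hΓ a' h'.1, level_stickSite, level_stickSite, zero_add,
    zero_add] at this
  subst this
  rw [add_right_cancel e]

@[to_additive]
lemma prod_cylinder {K : Type*} [CommMonoid K] (L : ℕ) (g : Site → K) :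
    ∏ x ∈ cylinder Γ L, g x = ∏ y ∈ Γ, ∏ l ∈ stickLevels L, g (y + stickSite l) := by
  rw [cylinder_eq_image, prod_image (injOn_add_stickSite hΓ L), prod_product]

lemma level_add_stickSite {y : Site} (hy : y ∈ Γ) (l : ℤ) : level (y + stickSite l) = l := by
  rw [level_add, hΓ y hy, level_stickSite, zero_add]

lemma card_cylinder {L : ℕ} (hL : Even L) : #(cylinder Γ L) = #Γ * (L + 1) := by
  rw [card_eq_sum_ones, sum_cylinder hΓ]
  simp [card_stickLevels hL]

lemma sum_cylinder_level (L : ℕ) (g : ℤ → ℝ) :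
    ∑ x ∈ cylinder Γ L, g (level x) = #Γ * ∑ l ∈ stickLevels L, g l := by
  rw [sum_cylinder hΓ, ← nsmul_eq_mul, ← sum_const]
  refine sum_congr rfl fun y hy => sum_congr rfl fun l _ => ?_
  rw [level_add_stickSite hΓ hy]

lemma bernPoly_cylinder (L : ℕ) (p : ℤ → ℝ) :
    bernPoly (cylinder Γ L) (fun x => p (level x)) 1 = bernPoly (stickLevels L) p 1 ^ #Γ := by
  rw [bernPoly, prod_cylinder hΓ, ← prod_const]
  refine prod_congr rfl fun y hy => prod_congr rfl fun l _ => ?_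
  rw [level_add_stickSite hΓ hy]
  rfl

lemma disjoint_cylinder {Γ₁ Γ₂ : Finset Site} (h₁ : Γ₁ ⊆ Γ) (h₂ : Γ₂ ⊆ Γ) (h : Disjoint Γ₁ Γ₂)
    (L : ℕ) : Disjoint (cylinder Γ₁ L) (cylinder Γ₂ L) := by
  rw [Finset.disjoint_left] at h ⊢
  intro x hx hx'
  simp only [cylinder_eq_image, mem_image, mem_product, Prod.exists] at hx hx'
  obtain ⟨a, l, ⟨ha, hl⟩, rfl⟩ := hx
  obtain ⟨a', l', ⟨ha', hl'⟩, e⟩ := hx'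
  have := injOn_add_stickSite hΓ L (x₁ := (a', l')) (x₂ := (a, l))
    (mem_coe.2 (mem_product.2 ⟨h₂ ha', hl'⟩)) (mem_coe.2 (mem_product.2 ⟨h₁ ha, hl⟩)) e
  rw [Prod.mk.injEq] at this
  exact h ha (this.1 ▸ ha')

end cylinders

lemma cylinder_union (Γ₁ Γ₂ : Finset Site) (L : ℕ) :
    cylinder (Γ₁ ∪ Γ₂) L = cylinder Γ₁ L ∪ cylinder Γ₂ L :=
  image₂_union_left

/-! ### The canonical and the grand canonical expectation -/

lemma norm_phaseFactor (φ : Site → ℝ) (x : Site) : ‖phaseFactor φ x‖ = 1 := by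
  rw [phaseFactor, mul_comm, Complex.norm_exp_ofReal_mul_I]

lemma norm_eval_one_bernPoly_le {ι : Type*} {p : ι → ℝ} (s : Finset ι) (h0 : ∀ i ∈ s, 0 ≤ p i)
    (h1 : ∀ i ∈ s, p i ≤ 1) {z : ι → ℂ} (hz : ∀ i ∈ s, ‖z i‖ ≤ 1) :
    ‖(bernPoly s (fun i => (p i : ℂ)) z).eval 1‖ ≤ 1 := by
  rw [← sum_coeff_eq_eval_one _ (Nat.lt_succ_of_le (natDegree_bernPoly_le _ _ _))]
  refine (norm_sum_le_of_le _ fun k _ => norm_coeff_bernPoly_le h0 h1 hz k).trans (le_of_eq ?_)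
  rw [sum_coeff_eq_eval_one _ (Nat.lt_succ_of_le (natDegree_bernPoly_le _ _ _)),
    eval_one_bernPoly]

lemma large_variance_bound {A m v : ℝ} (hm : 1 ≤ m) (hA : 16 * m ^ 2 < A) (hv : 0 < v) :
    0.4434 / ((A - m) * v) * √(2 * (m * v)) / (0.19 / √(A * v)) ≤ 4 * m / √A := by
  have hA0 : 0 < A := by nlinarith
  have hM : 15 / 16 * A ≤ A - m := by nlinarith
  have hM0 : 0 < A - m := by linarith
  have e : √(2 * (m * v)) * √(A * v) = v * √(2 * m) * √A := by
    rw [← Real.sqrt_mul (by positivity), show 2 * (m * v) * (A * v) = v ^ 2 * (2 * m * A) by ring,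
      Real.sqrt_mul (by positivity), Real.sqrt_sq hv.le, Real.sqrt_mul (by positivity), mul_assoc]
  have h2 : √(2 * m) ≤ 1.4143 * m := by
    rw [Real.sqrt_le_left (by positivity)]
    nlinarith
  have hsA : 0 < √A := Real.sqrt_pos.2 hA0
  have hsv : 0 < √(A * v) := Real.sqrt_pos.2 (by positivity)
  calc 0.4434 / ((A - m) * v) * √(2 * (m * v)) / (0.19 / √(A * v))
      = 0.4434 / 0.19 * (√(2 * (m * v)) * √(A * v)) / ((A - m) * v) := by
        field_simp
    _ = 0.4434 / 0.19 * √(2 * m) * √A / (A - m) := by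
        rw [e]
        field_simp
    _ ≤ 0.4434 / 0.19 * (1.4143 * m) * √A / (15 / 16 * A) := by gcongr
    _ = 0.4434 / 0.19 * 1.4143 * (16 / 15) * m * (√A / A) := by ring
    _ = 0.4434 / 0.19 * 1.4143 * (16 / 15) * m / √A := by
        rw [Real.sqrt_div_self, div_eq_mul_inv _ (√A)]
    _ ≤ 4 * m / √A := by gcongr; norm_num

lemma derivative_pow_mul_pow {K : Type*} [Field K] [CharZero K] (W : K[X]) {m A : ℕ} (hm : m ≤ A)
    (hA : 0 < A) :
    derivative (W ^ m) * W ^ (A - m) = C ((m : K) / A) * derivative (W ^ m * W ^ (A - m)) := by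
  rw [← pow_add, Nat.add_sub_cancel' hm, derivative_pow, derivative_pow]
  rcases m with _ | m
  · simp
  have hA' : (A : K) ≠ 0 := by exact_mod_cast hA.ne'
  have e1 : W ^ (m + 1 - 1) * W ^ (A - (m + 1)) = W ^ (A - 1) := by
    rw [← pow_add]
    congr 1
    omega
  have e2 : C (((m + 1 : ℕ) : K) / A) * C (A : K) = C ((m + 1 : ℕ) : K) := by
    rw [← C_mul, div_mul_cancel₀ _ hA']
  rw [← e1, ← e2]
  ring

/-- The canonical and the grand canonical expectation of a phase operator with support in a small
cylinder are close to each other. -/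
theorem norm_canonical_sub_gcExpectation_le {q : ℝ} (hq0 : 0 < q) (hq1 : q < 1) {L : ℕ}
    (hL : Even L) {Γ Γ₀ : Finset Site} (hΓ : ∀ x ∈ Γ, level x = 0) (hsub : Γ₀ ⊆ Γ)
    (hne : Γ₀.Nonempty) {μ : ℝ} {n : ℕ} {φ : Site → ℝ} (hφ : ∀ x, x ∉ cylinder Γ₀ L → φ x = 0)
    (hμ : gcExpectation q (stick L) μ (numberOp (stick L)) =
      (n : ℂ) / (#(cylinder Γ L) : ℂ) * ((L : ℂ) + 1))
    (hlt : 2 * (#Γ₀ : ℝ) < q ^ 2 * √(#Γ : ℝ)) :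
    ‖inner ℂ (groundState q (cylinder Γ L) n) (perturbedState q (cylinder Γ L) n φ) /
        inner ℂ (groundState q (cylinder Γ L) n) (groundState q (cylinder Γ L) n) -
      gcExpectation q (cylinder Γ L) μ (phaseOp (cylinder Γ L) φ)‖ ≤
        4 * (#Γ₀ : ℝ) / (q ^ 2 * √(#Γ : ℝ) - 2 * #Γ₀) := by
  set A : ℝ := (#Γ : ℝ) with hAdef
  set m : ℝ := (#Γ₀ : ℝ) with hmdef
  have hm1 : 1 ≤ m := by
    rw [hmdef]
    exact_mod_cast hne.card_pos
  have hq2 : q ^ 2 < 1 := by nlinarith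
  have hden : 0 < q ^ 2 * √A - 2 * m := by linarith
  have hsA : 0 < √A := by
    by_contra h
    have : q ^ 2 * √A ≤ 0 := mul_nonpos_of_nonneg_of_nonpos (by positivity) (not_lt.1 h)
    linarith
  have hA0 : 0 < A := Real.sqrt_pos.1 hsA
  have hAnat : 0 < #Γ := by rw [hAdef] at hA0; exact_mod_cast hA0
  have hΓ₀ : ∀ x ∈ Γ₀, level x = 0 := fun x hx => hΓ x (hsub hx)
  have hΓ₁ : ∀ x ∈ Γ \ Γ₀, level x = 0 := fun x hx => hΓ x (sdiff_subset hx)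
  have hcardsub : #Γ₀ ≤ #Γ := card_le_card hsub
  have hcard₁ : #(Γ \ Γ₀) = #Γ - #Γ₀ := card_sdiff_of_subset hsub
  have hcard₁' : (#(Γ \ Γ₀) : ℝ) = A - m := by
    rw [hcard₁, Nat.cast_sub hcardsub]
  set p : Site → ℝ := fun x => levelProb q μ (level x) with hp
  set s := cylinder Γ₀ L with hs
  set t := cylinder (Γ \ Γ₀) L with ht
  have p0 : ∀ x, 0 < p x := fun x => levelProb_pos hq0 μ _
  have p1 : ∀ x, p x < 1 := fun x => levelProb_lt_one hq0 μ _
  have hst : cylinder Γ L = s ∪ t := by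
    rw [hs, ht, ← cylinder_union, union_sdiff_of_subset hsub]
  have hdisj : Disjoint s t :=
    disjoint_cylinder hΓ hsub sdiff_subset disjoint_sdiff L
  set z := phaseFactor φ with hz
  have hz1 : ∀ x ∈ s, ‖z x‖ ≤ 1 := fun x _ => (norm_phaseFactor φ x).le
  have hzt : ∀ x ∈ t, z x = (1 : Site → ℂ) x := by
    intro x hx
    have := hφ x fun h => disjoint_left.1 hdisj h hx
    simp [hz, phaseFactor, this]
  have hC : bernPoly (cylinder Γ L) (fun x => (p x : ℂ)) z =
      bernPoly s (fun x => (p x : ℂ)) z * bernPoly t (fun x => (p x : ℂ)) 1 := by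
    rw [hst, bernPoly_union_disjoint hdisj, bernPoly_congr hzt]
  have hG : bernPoly (cylinder Γ L) p 1 = bernPoly s p 1 * bernPoly t p 1 := by
    rw [hst, bernPoly_union_disjoint hdisj]
  have hGC : gcExpectation q (cylinder Γ L) μ (phaseOp (cylinder Γ L) φ) =
      (bernPoly s (fun x => (p x : ℂ)) z).eval 1 := by
    rw [gcExpectation_phaseOp hq0]
    change (bernPoly (cylinder Γ L) (fun x => (p x : ℂ)) z).eval 1 = _
    rw [hC, eval_mul, eval_one_bernPoly, mul_one]
  have hCan : inner ℂ (groundState q (cylinder Γ L) n) (perturbedState q (cylinder Γ L) n φ) /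
        inner ℂ (groundState q (cylinder Γ L) n) (groundState q (cylinder Γ L) n) =
      (bernPoly s (fun x => (p x : ℂ)) z * bernPoly t (fun x => (p x : ℂ)) 1).coeff n /
        ((bernPoly s p 1 * bernPoly t p 1).coeff n : ℂ) := by
    rw [inner_groundState_perturbedState_div hq0 n φ μ]
    change (bernPoly (cylinder Γ L) (fun x => (p x : ℂ)) z).coeff n /
      ((bernPoly (cylinder Γ L) p 1).coeff n : ℂ) = _
    rw [hC, hG]
  rw [hGC, hCan]
  rcases le_or_gt (q ^ 2 * √A) (4 * m) with hbig | hbig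
  · have h2 : 2 ≤ 4 * m / (q ^ 2 * √A - 2 * m) := by
      rw [le_div_iff₀ hden]
      linarith
    refine ((norm_sub_le _ _).trans ?_).trans h2
    have b1 := norm_eval_one_bernPoly_le s (fun x _ => (p0 x).le) (fun x _ => (p1 x).le) hz1
    have b2 : ‖(bernPoly s (fun x => (p x : ℂ)) z * bernPoly t (fun x => (p x : ℂ)) 1).coeff n /
        ((bernPoly s p 1 * bernPoly t p 1).coeff n : ℂ)‖ ≤ 1 := by
      rw [← hG, ← hC, norm_div, Complex.norm_real]
      refine div_le_one_of_le₀ ?_ (norm_nonneg _)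
      refine (norm_coeff_bernPoly_le (fun x _ => (p0 x).le) (fun x _ => (p1 x).le)
        (fun x _ => (norm_phaseFactor φ x).le) n).trans (le_abs_self _)
    linarith
  have hA16 : 16 * m ^ 2 < A := by
    have h4 : 4 * m < √A := by nlinarith
    have := Real.sq_sqrt hA0.le
    nlinarith
  have hlast : 4 * m / √A ≤ 4 * m / (q ^ 2 * √A - 2 * m) := by
    gcongr
    nlinarith
  refine le_trans ?_ hlast
  set v := ∑ l ∈ stickLevels L, levelProb q μ l * (1 - levelProb q μ l) with hv
  have hv0 : 0 ≤ v := sum_nonneg fun l _ =>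
    mul_nonneg (levelProb_pos hq0 μ l).le (sub_nonneg.2 (levelProb_lt_one hq0 μ l).le)
  have vs : ∑ x ∈ s, p x * (1 - p x) = m * v :=
    sum_cylinder_level hΓ₀ L fun l => levelProb q μ l * (1 - levelProb q μ l)
  have vt : ∑ x ∈ t, p x * (1 - p x) = (A - m) * v := by
    rw [← hcard₁']
    exact sum_cylinder_level hΓ₁ L fun l => levelProb q μ l * (1 - levelProb q μ l)
  have hmean : ∑ x ∈ cylinder Γ L, p x = n := by
    have h1 : ∑ x ∈ cylinder Γ L, p x = A * ∑ l ∈ stickLevels L, levelProb q μ l :=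
      sum_cylinder_level hΓ L fun l => levelProb q μ l
    rw [gcExpectation_numberOp hq0, card_cylinder hΓ hL, stick,
      sum_image injective_stickSite.injOn] at hμ
    simp only [level_stickSite] at hμ
    have h2 : ∑ l ∈ stickLevels L, levelProb q μ l = n / (A * (L + 1)) * (L + 1) := by
      apply Complex.ofReal_injective
      rw [hμ, hAdef]
      push_cast
      rfl
    rw [h1, h2]
    have : (L : ℝ) + 1 ≠ 0 := by positivity
    field_simp
  have hmean' : ∑ x ∈ s, p x + ∑ x ∈ t, p x = n := by
    rw [← sum_union hdisj, ← hst, hmean]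
  rcases le_or_gt v 4 with hv4 | hv4
  · have hder : derivative (bernPoly s p 1) * bernPoly t p 1 =
        C (m / A) * derivative (bernPoly s p 1 * bernPoly t p 1) := by
      have e1 : bernPoly s p 1 = _ := bernPoly_cylinder hΓ₀ L (levelProb q μ)
      have e2 : bernPoly t p 1 = _ := bernPoly_cylinder hΓ₁ L (levelProb q μ)
      rw [e1, e2, hcard₁]
      exact derivative_pow_mul_pow _ hcardsub hAnat
    refine (norm_canonical_sub_le_sqrt_variance (fun x _ => p0 x) (fun x _ => p1 x)
      (fun x _ => p0 x) (fun x _ => p1 x) hz1 hmean' (r := m / A) (by positivity) hder).trans ?_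
    rw [vs, vt, ← add_mul, add_sub_cancel]
    have h1 : √(A * v) ≤ √A * 2 := by
      rw [Real.sqrt_mul hA0.le]
      gcongr
      rw [Real.sqrt_le_left zero_le_two]
      linarith
    calc 2 * (m / A) * √(A * v) ≤ 2 * (m / A) * (√A * 2) := by gcongr
      _ = 4 * m * (√A / A) := by ring
      _ = 4 * m / √A := by rw [Real.sqrt_div_self, div_eq_mul_inv _ (√A)]
  · have hv0' : 0 < v := by linarith
    have hAv : 64 ≤ A * v := by nlinarith
    have hMv : 60 ≤ (A - m) * v := by nlinarith
    have hGn := le_coeff_bernPoly_mean (cylinder Γ L) (fun x _ => (p0 x).le)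
      (fun x _ => (p1 x).le) hmean (V := A * v)
      (sum_cylinder_level hΓ L fun l => levelProb q μ l * (1 - levelProb q μ l)) hAv
    rw [hG] at hGn
    have hsv : 0 < √(A * v) := Real.sqrt_pos.2 (by positivity)
    refine (norm_canonical_sub_le_of_increments (fun x _ => (p0 x).le) (fun x _ => (p1 x).le) hz1
      (lt_of_lt_of_le (by positivity) hGn) (by positivity)
      (abs_zcoeff_bernPoly_succ_sub_le t vt hMv)).trans ?_
    rw [vs]
    refine le_trans ?_ (large_variance_bound hm1 hA16 hv0')
    have : 0 < (A - m) * v := by linarith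
    gcongr

end

section

open MeasureTheory

/-! ### The hexagonal cell -/

/-- The hexagon spanned by `±(1, 0)`, `±(1 / 2, 1)`, `±(1 / 2, -1)` in the coordinates
`(t, s) ↦ (s, t)`. -/
def modelHexagon : Set (ℝ × ℝ) := {x | |x.1| ≤ 1 ∧ |2 * x.2 + x.1| ≤ 2 ∧ |2 * x.2 - x.1| ≤ 2}

lemma mem_modelHexagon_iff (t s : ℝ) :
    (t, s) ∈ modelHexagon ↔ t ∈ Set.Icc (-1) 1 ∧ s ∈ Set.Icc (-(1 - |t| / 2)) (1 - |t| / 2) := by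
  simp only [modelHexagon, Set.mem_ofPred_eq, Set.mem_Icc, abs_le]
  rcases abs_cases t with ⟨h, _⟩ | ⟨h, _⟩ <;> rw [h] <;> constructor <;>
    (intro _; refine ⟨⟨?_, ?_⟩, ?_⟩) <;> (try refine ⟨?_, ?_⟩) <;> (try refine ⟨?_, ?_⟩) <;> linarith

lemma isCompact_modelHexagon : IsCompact modelHexagon := by
  have hc : IsClosed modelHexagon := by
    simp only [modelHexagon, Set.ofPred_and]
    exact (isClosed_le (by fun_prop) (by fun_prop)).inter
      ((isClosed_le (by fun_prop) (by fun_prop)).inter (isClosed_le (by fun_prop) (by fun_prop)))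
  refine (isCompact_Icc (a := ((-1, -1) : ℝ × ℝ)) (b := (1, 1))).of_isClosed_subset hc ?_
  rintro ⟨t, s⟩ h
  rw [mem_modelHexagon_iff] at h
  have := abs_nonneg t
  exact ⟨⟨h.1.1, by linarith [h.2.1]⟩, ⟨h.1.2, by linarith [h.2.2]⟩⟩

lemma setIntegral_modelHexagon (a b c : ℝ) :
    ∫ x in modelHexagon, (a + b * x.2 ^ 2 + c * x.1 ^ 2) = 3 * a + 5 / 8 * b + 5 / 6 * c := by
  have hm := isCompact_modelHexagon.measurableSet
  have hint : Integrable (modelHexagon.indicator fun x => a + b * x.2 ^ 2 + c * x.1 ^ 2)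
      (volume.prod volume) := by
    rw [integrable_indicator_iff hm]
    exact (Continuous.continuousOn (by fun_prop)).integrableOn_compact isCompact_modelHexagon
  rw [← integral_indicator hm, Measure.volume_eq_prod, integral_prod _ hint]
  have inner : ∀ t : ℝ, ∫ s, modelHexagon.indicator (fun x => a + b * x.2 ^ 2 + c * x.1 ^ 2) (t, s) =
      (Set.Icc (-1 : ℝ) 1).indicator (fun t => 2 * (a + c * t ^ 2) * (1 - |t| / 2) +
        2 / 3 * b * (1 - |t| / 2) ^ 3) t := by
    intro t
    by_cases ht : t ∈ Set.Icc (-1 : ℝ) 1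
    · rw [Set.indicator_of_mem ht]
      have e : (fun s => modelHexagon.indicator (fun x => a + b * x.2 ^ 2 + c * x.1 ^ 2) (t, s)) =
          (Set.Icc (-(1 - |t| / 2)) (1 - |t| / 2)).indicator
            (fun s => a + b * s ^ 2 + c * t ^ 2) := by
        ext s
        simp only [Set.indicator, mem_modelHexagon_iff, ht, true_and]
      have hw : -(1 - |t| / 2) ≤ 1 - |t| / 2 := by
        have := abs_le.2 ht
        linarith
      rw [e, integral_indicator measurableSet_Icc, integral_Icc_eq_integral_Ioc,
        ← intervalIntegral.integral_of_le hw,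
        intervalIntegral.integral_add (Continuous.intervalIntegrable (by fun_prop) _ _)
          (Continuous.intervalIntegrable (by fun_prop) _ _),
        intervalIntegral.integral_add (Continuous.intervalIntegrable (by fun_prop) _ _)
          (Continuous.intervalIntegrable (by fun_prop) _ _), intervalIntegral.integral_const_mul,
        integral_pow]
      simp only [intervalIntegral.integral_const, smul_eq_mul]
      ring
    · rw [Set.indicator_of_notMem ht]
      have e : (fun s => modelHexagon.indicator (fun x => a + b * x.2 ^ 2 + c * x.1 ^ 2) (t, s)) =
          fun _ => 0 := by
        ext s
        simp only [Set.indicator, mem_modelHexagon_iff, ht, false_and, if_false]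
      rw [e, integral_zero]
  simp only [inner]
  rw [integral_indicator measurableSet_Icc, integral_Icc_eq_integral_Ioc,
    ← intervalIntegral.integral_of_le (by norm_num),
    ← intervalIntegral.integral_add_adjacent_intervals (b := 0)
      (Continuous.intervalIntegrable (by fun_prop) _ _)
      (Continuous.intervalIntegrable (by fun_prop) _ _)]
  have e1 : ∫ t in (-1 : ℝ)..0, (2 * (a + c * t ^ 2) * (1 - |t| / 2) +
      2 / 3 * b * (1 - |t| / 2) ^ 3) = ∫ t in (0 : ℝ)..1, (2 * (a + c * t ^ 2) * (1 - |t| / 2) +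
      2 / 3 * b * (1 - |t| / 2) ^ 3) := by
    have := intervalIntegral.integral_comp_neg (a := -1) (b := 0)
      fun t : ℝ => 2 * (a + c * t ^ 2) * (1 - |t| / 2) + 2 / 3 * b * (1 - |t| / 2) ^ 3
    simpa using this
  have e2 : ∫ t in (0 : ℝ)..1, (2 * (a + c * t ^ 2) * (1 - |t| / 2) +
      2 / 3 * b * (1 - |t| / 2) ^ 3) = 3 / 2 * a + 5 / 16 * b + 5 / 12 * c := by
    have hd : ∀ t ∈ Set.uIcc (0 : ℝ) 1, HasDerivAt
        (fun t : ℝ => 2 * a * (t - t ^ 2 / 4) + 2 * c * (t ^ 3 / 3 - t ^ 4 / 8) -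
          1 / 3 * b * (1 - t / 2) ^ 4)
        (2 * (a + c * t ^ 2) * (1 - |t| / 2) + 2 / 3 * b * (1 - |t| / 2) ^ 3) t := by
      intro t ht
      rw [Set.uIcc_of_le zero_le_one] at ht
      rw [abs_of_nonneg ht.1]
      have h1 := hasDerivAt_id t
      have h2 := ((h1.sub ((hasDerivAt_pow 2 t).div_const 4)).const_mul (2 * a)).add
        ((((hasDerivAt_pow 3 t).div_const 3).sub ((hasDerivAt_pow 4 t).div_const 8)).const_mul
          (2 * c))
      have h3 := (((h1.div_const 2).const_sub 1).pow 4).const_mul (1 / 3 * b)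
      refine HasDerivAt.congr_deriv (h2.sub h3) ?_
      simp only [id]
      norm_num
      ring
    rw [intervalIntegral.integral_eq_sub_of_hasDerivAt hd
      (Continuous.intervalIntegrable (by fun_prop) _ _)]
    ring
  rw [e1, e2]
  ring

/-- The plane. -/
abbrev Plane : Type := EuclideanSpace ℝ (Fin 2)

/-- Coordinates in which the Voronoi domains of the triangular lattice are rational. -/
def hexCoord : Plane ≃L[ℝ] ℝ × ℝ :=
  LinearEquiv.toContinuousLinearEquiv
    { toFun := fun y => (√2 * y 1, √6 / 2 * y 0)
      invFun := fun x => !₂[x.2 * (2 / √6), x.1 / √2]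
      map_add' := fun y z => by
        simp only [PiLp.add_apply, mul_add, Prod.mk_add_mk]
      map_smul' := fun c y => by
        simp only [PiLp.smul_apply, smul_eq_mul, RingHom.id_apply, Prod.smul_mk, mul_left_comm]
      left_inv := fun y => by
        ext i
        fin_cases i
        · simp
          field_simp
        · simp
      right_inv := fun x => by
        ext
        · simp
          field_simp
        · simp
          field_simp }

lemma hexCoord_apply (y : Plane) : hexCoord y = (√2 * y 1, √6 / 2 * y 0) := rfl

/-- The Voronoi domain of the origin. -/
def hexagon : Set Plane := hexCoord ⁻¹' modelHexagon

lemma exists_setIntegral_hexagon_eq : ∃ κ : ℝ, 0 < κ ∧ ∀ g : ℝ × ℝ → ℝ,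
    ∫ y in hexagon, g (hexCoord y) = κ * ∫ x in modelHexagon, g x := by
  have : (Measure.map hexCoord (volume : Measure Plane)).IsAddHaarMeasure :=
    hexCoord.isAddHaarMeasure_map _
  set c := Measure.addHaarScalarFactor (Measure.map hexCoord (volume : Measure Plane))
    (volume : Measure (ℝ × ℝ))
  have hc := Measure.isAddLeftInvariant_eq_smul
    (Measure.map hexCoord (volume : Measure Plane)) (volume : Measure (ℝ × ℝ))
  refine ⟨c, Measure.addHaarScalarFactor_pos_of_isAddHaarMeasure _ _, fun g => ?_⟩
  have e := setIntegral_map_equiv (μ := (volume : Measure Plane))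
    hexCoord.toHomeomorph.toMeasurableEquiv g modelHexagon
  have e2 : Measure.map (hexCoord.toHomeomorph.toMeasurableEquiv) (volume : Measure Plane) =
      c • (volume : Measure (ℝ × ℝ)) := hc
  rw [e2, Measure.restrict_smul, integral_smul_nnreal_measure] at e
  exact e.symm

lemma isCompact_hexagon : IsCompact hexagon :=
  hexCoord.toHomeomorph.isCompact_preimage.2 isCompact_modelHexagon

lemma measurableSet_hexagon : MeasurableSet hexagon := isCompact_hexagon.measurableSet

lemma volume_hexagon_pos : 0 < (volume hexagon).toReal := by
  obtain ⟨κ, hκ, h⟩ := exists_setIntegral_hexagon_eq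
  have h1 := h fun _ => 1
  have h2 := setIntegral_modelHexagon 1 0 0
  simp only [zero_mul, add_zero] at h2
  rw [h2, setIntegral_const, smul_eq_mul, mul_one] at h1
  change 0 < volume.real hexagon
  rw [h1]
  positivity

lemma setIntegral_hexagon (a b c : ℝ) :
    ∫ y in hexagon, (a + b * (hexCoord y).2 ^ 2 + c * (hexCoord y).1 ^ 2) =
      (a + 5 / 24 * b + 5 / 18 * c) * (volume hexagon).toReal := by
  obtain ⟨κ, hκ, h⟩ := exists_setIntegral_hexagon_eq
  have h1 := h fun _ => 1
  have h2 := setIntegral_modelHexagon 1 0 0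
  simp only [zero_mul, add_zero] at h2
  rw [h2, setIntegral_const, smul_eq_mul, mul_one] at h1
  change _ = _ * volume.real hexagon
  rw [h fun x => a + b * x.2 ^ 2 + c * x.1 ^ 2, setIntegral_modelHexagon, h1]
  ring

lemma neg_mem_hexagon {y : Plane} : -y ∈ hexagon ↔ y ∈ hexagon := by
  simp only [hexagon, Set.mem_preimage, map_neg, modelHexagon, Set.mem_ofPred_eq, Prod.fst_neg,
    Prod.snd_neg, abs_neg]
  rw [show 2 * -(hexCoord y).2 + -(hexCoord y).1 = -(2 * (hexCoord y).2 + (hexCoord y).1) by ring,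
    show 2 * -(hexCoord y).2 - -(hexCoord y).1 = -(2 * (hexCoord y).2 - (hexCoord y).1) by ring,
    abs_neg, abs_neg]

lemma setIntegral_hexagon_neg (g : Plane → ℝ) :
    ∫ y in hexagon, g (-y) = ∫ y in hexagon, g y := by
  rw [← integral_indicator measurableSet_hexagon, ← integral_indicator measurableSet_hexagon,
    ← integral_neg_eq_self (hexagon.indicator g)]
  congr 1
  ext y
  by_cases h : y ∈ hexagon
  · rw [Set.indicator_of_mem h, Set.indicator_of_mem (neg_mem_hexagon.2 h)]
  · rw [Set.indicator_of_notMem h, Set.indicator_of_notMem (mt neg_mem_hexagon.1 h)]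

lemma convex_hexagon : Convex ℝ hexagon := by
  have h : ∀ (f : ℝ × ℝ →ₗ[ℝ] ℝ) (r : ℝ), Convex ℝ {x | |f x| ≤ r} := by
    intro f r
    simp only [abs_le, Set.ofPred_and]
    exact (convex_halfSpace_ge f.isLinear _).inter (convex_halfSpace_le f.isLinear _)
  have h1 := h (LinearMap.fst ℝ ℝ ℝ) 1
  have h2 := h ((2 : ℝ) • LinearMap.snd ℝ ℝ ℝ + LinearMap.fst ℝ ℝ ℝ) 2
  have h3 := h ((2 : ℝ) • LinearMap.snd ℝ ℝ ℝ - LinearMap.fst ℝ ℝ ℝ) 2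
  have : modelHexagon = {x | |LinearMap.fst ℝ ℝ ℝ x| ≤ 1} ∩
      ({x | |((2 : ℝ) • LinearMap.snd ℝ ℝ ℝ + LinearMap.fst ℝ ℝ ℝ) x| ≤ 2} ∩
      {x | |((2 : ℝ) • LinearMap.snd ℝ ℝ ℝ - LinearMap.fst ℝ ℝ ℝ) x| ≤ 2}) := by
    ext x
    simp [modelHexagon]
  rw [hexagon, this]
  exact (h1.inter (h2.inter h3)).linear_preimage (hexCoord : Plane →ₗ[ℝ] ℝ × ℝ)

/-- The offsets of the sites of a stick from its axis: the centre and two vertices of the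
hexagon. -/
def IsOffset (o : Plane) : Prop :=
  hexCoord o = (0, 0) ∨ hexCoord o = (0, 1) ∨ hexCoord o = (1, 1 / 2)

lemma IsOffset.mem_hexagon {o : Plane} (h : IsOffset o) : o ∈ hexagon := by
  rw [hexagon, Set.mem_preimage]
  rcases h with h | h | h <;> rw [h] <;> norm_num [modelHexagon]

lemma abs_hexCoord_le_one {y : Plane} (hy : y ∈ hexagon) :
    |(hexCoord y).1| ≤ 1 ∧ |(hexCoord y).2| ≤ 1 := by
  have h := (mem_modelHexagon_iff (hexCoord y).1 (hexCoord y).2).1 hy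
  have := abs_nonneg (hexCoord y).1
  exact ⟨abs_le.2 h.1, abs_le.2 ⟨by linarith [h.2.1], by linarith [h.2.2]⟩⟩

lemma abs_add_abs_eq_hexCoord (y o : Plane) :
    |y 0 - o 0| + |y 1 - o 1| = 2 / √6 * (|(hexCoord y).2 - (hexCoord o).2| +
      √3 / 2 * |(hexCoord y).1 - (hexCoord o).1|) := by
  have h6 : 0 < √6 := by positivity
  have h2 : 0 < √2 := by positivity
  have h63 : √6 = √2 * √3 := by rw [← Real.sqrt_mul (by norm_num)]; norm_num
  simp only [hexCoord_apply, ← mul_sub, abs_mul]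
  rw [abs_of_pos h2, abs_of_pos (show 0 < √6 / 2 by positivity), mul_add]
  congr 1
  · field_simp
  · rw [h63]
    field_simp

lemma setIntegral_hexagon_le {a b c : ℝ} {F : Plane → ℝ} (hF : Continuous F)
    (h : ∀ y ∈ hexagon, F y + F (-y) ≤
      2 / √6 * (a + b * (hexCoord y).2 ^ 2 + c * (hexCoord y).1 ^ 2)) :
    ∫ y in hexagon, F y ≤ 1 / √6 * (a + 5 / 24 * b + 5 / 18 * c) * (volume hexagon).toReal := by
  have hi : ∀ g : Plane → ℝ, Continuous g → IntegrableOn g hexagon := fun g hg =>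
    hg.continuousOn.integrableOn_compact isCompact_hexagon
  have h1 := setIntegral_mono_on ((hi F hF).add (hi (fun y => F (-y)) (by fun_prop)))
    (hi (fun y => 2 / √6 * (a + b * (hexCoord y).2 ^ 2 + c * (hexCoord y).1 ^ 2)) (by fun_prop))
    measurableSet_hexagon h
  have h2 := integral_add (hi F hF) (hi (fun y => F (-y)) (by fun_prop))
  rw [setIntegral_hexagon_neg] at h2
  simp only [Pi.add_apply] at h1
  rw [integral_const_mul, setIntegral_hexagon, h2] at h1
  have : 2 / √6 = 2 * (1 / √6) := by ring
  rw [this] at h1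
  linarith

/-- The mean `ℓ¹` distance of the points of the hexagon from its centre or a vertex. -/
lemma setIntegral_hexagon_dist_le {o : Plane} (h : IsOffset o) :
    ∫ y in hexagon, (|y 0 - o 0| + |y 1 - o 1|) ≤ √6 / 2 * (volume hexagon).toReal := by
  have hcont : Continuous fun y : Plane => |y 0 - o 0| + |y 1 - o 1| := by fun_prop
  have h3 : √3 ≤ 1.7321 := by
    rw [Real.sqrt_le_left (by norm_num)]
    norm_num
  have h30 : 0 ≤ √3 := Real.sqrt_nonneg 3
  have h6 : 0 < √6 := by positivity
  have h66 : √6 / 2 = 1 / √6 * 3 := by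
    field_simp
    rw [Real.sq_sqrt (by norm_num)]
    norm_num
  suffices key : ∃ a b c : ℝ, a + 5 / 24 * b + 5 / 18 * c ≤ 3 ∧ ∀ y ∈ hexagon,
      (|(hexCoord y).2 - (hexCoord o).2| + √3 / 2 * |(hexCoord y).1 - (hexCoord o).1|) +
      (|-(hexCoord y).2 - (hexCoord o).2| + √3 / 2 * |-(hexCoord y).1 - (hexCoord o).1|) ≤
      a + b * (hexCoord y).2 ^ 2 + c * (hexCoord y).1 ^ 2 by
    obtain ⟨a, b, c, habc, hle⟩ := key
    refine (setIntegral_hexagon_le (a := a) (b := b) (c := c) hcont fun y hy => ?_).trans ?_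
    · rw [abs_add_abs_eq_hexCoord, abs_add_abs_eq_hexCoord, ← mul_add, map_neg]
      exact mul_le_mul_of_nonneg_left (hle y hy) (by positivity)
    · rw [h66]
      gcongr
  have sq_bound : ∀ t : ℝ, |t| ≤ t ^ 2 + 1 / 4 := fun t => by
    rw [← sq_abs]
    nlinarith [sq_nonneg (|t| - 1 / 2)]
  rcases h with h | h | h
  · refine ⟨1 / 2 + √3 / 4, 2, √3, by linarith, fun y _ => ?_⟩
    simp only [h, sub_zero, abs_neg]
    nlinarith [sq_bound (hexCoord y).1, sq_bound (hexCoord y).2]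
  · refine ⟨2 + √3 / 4, 0, √3, by linarith, fun y hy => ?_⟩
    have h1 := abs_le.1 (abs_hexCoord_le_one hy).2
    simp only [h, sub_zero, abs_neg]
    rw [abs_of_nonpos (a := (hexCoord y).2 - 1) (by linarith),
      abs_of_nonpos (a := -(hexCoord y).2 - 1) (by linarith)]
    nlinarith [sq_bound (hexCoord y).1]
  · refine ⟨1 + √3, 1, 0, by linarith, fun y hy => ?_⟩
    have h1 := abs_le.1 (abs_hexCoord_le_one hy).1
    simp only [h]
    rw [abs_of_nonpos (a := (hexCoord y).1 - 1) (by linarith),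
      abs_of_nonpos (a := -(hexCoord y).1 - 1) (by linarith)]
    have h2 : |(hexCoord y).2 - 1 / 2| + |-(hexCoord y).2 - 1 / 2| ≤ 1 + (hexCoord y).2 ^ 2 := by
      have a1 := sq_nonneg ((hexCoord y).2 - 1)
      have a2 := sq_nonneg ((hexCoord y).2 + 1)
      have a3 := sq_nonneg ((hexCoord y).2)
      rcases abs_cases ((hexCoord y).2 - 1 / 2) with h | h <;>
        rcases abs_cases (-(hexCoord y).2 - 1 / 2) with h' | h' <;> rw [h.1, h'.1] <;> nlinarith
    linarith

/-! ### Voronoi domains -/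

lemma planeCoord_add (x y : Site) : planeCoord (x + y) = planeCoord x + planeCoord y := by
  ext i
  fin_cases i <;> simp [planeCoord] <;> ring

lemma planeCoord_sub (x y : Site) : planeCoord (x - y) = planeCoord x - planeCoord y := by
  rw [eq_sub_iff_add_eq, ← planeCoord_add, sub_add_cancel]

lemma hexCoord_planeCoord (x : Site) :
    hexCoord (planeCoord x) = ((x 1 : ℝ) - x 2, (2 * (x 0 : ℝ) - x 1 - x 2) / 2) := by
  ext
  · simp [hexCoord_apply, planeCoord]
    field_simp
  · simp [hexCoord_apply, planeCoord]

lemma isOffset_planeCoord_stickSite (l : ℤ) : IsOffset (planeCoord (stickSite l)) := by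
  simp only [IsOffset, hexCoord_planeCoord, Prod.mk.injEq]
  have h : l % 3 = 0 ∨ l % 3 = 1 ∨ l % 3 = 2 := by omega
  simp only [stickSite, Matrix.cons_val_zero, Matrix.cons_val_one, Matrix.cons_val]
  rcases h with h | h | h
  · rw [show (l + 2) / 3 = l / 3 by omega, show (l + 1) / 3 = l / 3 by omega]
    left
    constructor <;> ring
  · rw [show (l + 2) / 3 = l / 3 + 1 by omega, show (l + 1) / 3 = l / 3 by omega]
    right; left
    push_cast
    constructor <;> ring
  · rw [show (l + 2) / 3 = l / 3 + 1 by omega, show (l + 1) / 3 = l / 3 + 1 by omega]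
    right; right
    push_cast
    constructor <;> ring

lemma dist_sq_eq_hexCoord (y z : Plane) :
    dist y z ^ 2 = 2 / 3 * ((hexCoord y).2 - (hexCoord z).2) ^ 2 +
      1 / 2 * ((hexCoord y).1 - (hexCoord z).1) ^ 2 := by
  rw [EuclideanSpace.dist_sq_eq, Fin.sum_univ_two, hexCoord_apply, hexCoord_apply,
    Real.dist_eq, Real.dist_eq, sq_abs, sq_abs]
  simp only [← mul_sub, mul_pow, div_pow]
  rw [Real.sq_sqrt (by norm_num), Real.sq_sqrt (by norm_num)]
  ring

/-- The Voronoi domain of the origin is the hexagon. -/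
lemma voronoiCell_zero : voronoiCell 0 = hexagon := by
  have key : ∀ (y : Plane) (z : Site), level z = 0 →
      (dist y (planeCoord 0) ≤ dist y (planeCoord z) ↔
        2 * (hexCoord y).2 * z 0 + (hexCoord y).1 * (z 1 - z 2) ≤
          (z 0 : ℝ) ^ 2 + (z 1 : ℝ) ^ 2 + (z 2 : ℝ) ^ 2) := by
    intro y z hz
    have hz' : (z 0 : ℝ) = -z 1 - z 2 := by
      have : (z 0 : ℝ) + z 1 + z 2 = 0 := by exact_mod_cast hz
      linarith
    rw [← sq_le_sq₀ dist_nonneg dist_nonneg, dist_sq_eq_hexCoord, dist_sq_eq_hexCoord,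
      hexCoord_planeCoord, hexCoord_planeCoord, hz']
    simp only [Pi.zero_apply, Int.cast_zero]
    constructor <;> intro h <;> nlinarith
  ext y
  simp only [voronoiCell, Set.mem_ofPred_eq]
  constructor
  · intro h
    have h' := fun z hz => (key y z hz).1 (h z hz)
    have a1 := h' ![0, 1, -1] rfl
    have a2 := h' ![0, -1, 1] rfl
    have a3 := h' ![1, -1, 0] rfl
    have a4 := h' ![-1, 1, 0] rfl
    have a5 := h' ![1, 0, -1] rfl
    have a6 := h' ![-1, 0, 1] rfl
    simp at a1 a2 a3 a4 a5 a6
    simp only [hexagon, modelHexagon, Set.mem_preimage, Set.mem_ofPred_eq, abs_le]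
    refine ⟨⟨?_, ?_⟩, ⟨?_, ?_⟩, ?_, ?_⟩ <;> linarith
  · rintro ⟨h1, h2, h3⟩ z hz
    rw [key y z hz]
    rw [abs_le] at h1 h2 h3
    set t := (hexCoord y).1
    set s := (hexCoord y).2
    obtain ⟨κ, k1, k2, k3⟩ : ∃ κ : ℝ, |2 * s - κ| ≤ 1 ∧ |t - κ| ≤ 1 ∧ |-t - κ| ≤ 1 := by
      simp only [abs_le]
      rcases le_total (2 * s) 1 with hs | hs
      · rcases le_total (-1) (2 * s) with hs' | hs'
        · exact ⟨0, ⟨by linarith, by linarith⟩, ⟨by linarith, by linarith⟩, by linarith,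
            by linarith⟩
        · exact ⟨2 * s + 1, ⟨by linarith, by linarith⟩, ⟨by linarith, by linarith⟩, by linarith,
            by linarith⟩
      · exact ⟨2 * s - 1, ⟨by linarith, by linarith⟩, ⟨by linarith, by linarith⟩, by linarith,
          by linarith⟩
    have hz' : (z 0 : ℝ) + z 1 + z 2 = 0 := by exact_mod_cast hz
    have bound : ∀ (c : ℝ) (k : ℤ), |c| ≤ 1 → c * k ≤ (k : ℝ) ^ 2 := by
      intro c k hc
      have h1 : |(k : ℝ)| ≤ (k : ℝ) ^ 2 := by
        rcases eq_or_ne k 0 with rfl | hk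
        · simp
        · have : (1 : ℝ) ≤ |(k : ℝ)| := by exact_mod_cast Int.one_le_abs hk
          rw [← sq_abs]
          nlinarith
      have h2 := le_abs_self (c * k)
      rw [abs_mul] at h2
      nlinarith [abs_nonneg (k : ℝ)]
    have b1 := bound _ (z 0) k1
    have b2 := bound _ (z 1) k2
    have b3 := bound _ (z 2) k3
    have : 2 * s * z 0 + t * (z 1 - z 2) = (2 * s - κ) * z 0 + (t - κ) * z 1 + (-t - κ) * z 2 +
      κ * ((z 0 : ℝ) + z 1 + z 2) := by ring
    rw [this, hz']
    linarith

lemma mem_voronoiCell_iff {x : Site} (hx : level x = 0) (y : Plane) :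
    y ∈ voronoiCell x ↔ y - planeCoord x ∈ hexagon := by
  rw [← voronoiCell_zero]
  have h0 : planeCoord 0 = 0 := by
    rw [← sub_self (0 : Site), planeCoord_sub, sub_self]
  have hl : ∀ a b : Site, level (a - b) = level a - level b := by
    intro a b
    simp only [level, Pi.sub_apply]
    ring
  simp only [voronoiCell, Set.mem_ofPred_eq, h0, dist_zero_right]
  constructor
  · intro h z hz
    have := h (z + x) (by rw [level_add, hz, hx, add_zero])
    rwa [planeCoord_add, add_comm, dist_eq_norm, dist_eq_norm, ← sub_sub, ← dist_eq_norm _ (planeCoord z)]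
      at this
  · intro h z hz
    have := h (z - x) (by rw [hl, hz, hx, sub_zero])
    rwa [planeCoord_sub, dist_sub_right, ← dist_eq_norm] at this

lemma planeCoord_injOn {x x' : Site} (hx : level x = 0) (hx' : level x' = 0)
    (h : planeCoord x = planeCoord x') : x = x' := by
  have h2 := congrArg hexCoord h
  rw [hexCoord_planeCoord, hexCoord_planeCoord, Prod.mk.injEq] at h2
  have e0 : (x 0 : ℝ) + x 1 + x 2 = 0 := by exact_mod_cast hx
  have e0' : (x' 0 : ℝ) + x' 1 + x' 2 = 0 := by exact_mod_cast hx'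
  have a0 : (x 0 : ℝ) = x' 0 := by linarith [h2.1, h2.2]
  have a1 : (x 1 : ℝ) = x' 1 := by linarith [h2.1, h2.2]
  have a2 : (x 2 : ℝ) = x' 2 := by linarith [h2.1, h2.2]
  ext i
  fin_cases i
  · exact_mod_cast a0
  · exact_mod_cast a1
  · exact_mod_cast a2

/-! ### Rescaled regions -/

section rescaling

/-- The rescaled Voronoi domain of the site `x`. -/
def scaledCell (R : ℝ) (x : Site) : Set Plane := {y | R • y ∈ voronoiCell x}

lemma rescaledRegion_eq (R : ℝ) (Γ : Finset Site) :
    rescaledRegion R Γ = ⋃ x ∈ Γ, scaledCell R x := by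
  ext y
  simp [rescaledRegion, baseRegion, scaledCell]

variable {R : ℝ} {x : Site} (hx : level x = 0)
include hx

lemma mem_scaledCell_iff (y : Plane) :
    y ∈ scaledCell R x ↔ R • y - planeCoord x ∈ hexagon := mem_voronoiCell_iff hx _

lemma convex_scaledCell : Convex ℝ (scaledCell R x) := by
  intro y hy z hz a b ha hb hab
  rw [mem_scaledCell_iff hx] at hy hz ⊢
  have := convex_hexagon hy hz ha hb hab
  convert this using 1
  nth_rewrite 1 [← one_smul ℝ (planeCoord x), ← hab]
  module

variable (hR : 0 < R)
include hR

lemma mem_scaledCell_of_isOffset {o : Plane} (ho : IsOffset o) :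
    R⁻¹ • (planeCoord x + o) ∈ scaledCell R x := by
  rw [mem_scaledCell_iff hx, smul_inv_smul₀ hR.ne', add_sub_cancel_left]
  exact ho.mem_hexagon

lemma isCompact_scaledCell : IsCompact (scaledCell R x) := by
  have e : scaledCell R x =
      ((Homeomorph.smulOfNeZero R hR.ne').trans (Homeomorph.subRight (planeCoord x))) ⁻¹' hexagon := by
    ext y
    rw [mem_scaledCell_iff hx]
    rfl
  rw [e, Homeomorph.isCompact_preimage]
  exact isCompact_hexagon

lemma setIntegral_scaledCell (g : Plane → ℝ) :
    ∫ y in scaledCell R x, g (R • y - planeCoord x) = (R ^ 2)⁻¹ * ∫ y in hexagon, g y := by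
  rw [← integral_indicator (isCompact_scaledCell hx hR).measurableSet,
    ← integral_indicator measurableSet_hexagon]
  have e : (scaledCell R x).indicator (fun y => g (R • y - planeCoord x)) =
      fun y => (fun w => hexagon.indicator g (w - planeCoord x)) (R • y) := by
    ext y
    beta_reduce
    by_cases h : y ∈ scaledCell R x
    · rw [Set.indicator_of_mem h, Set.indicator_of_mem ((mem_scaledCell_iff hx y).1 h)]
    · rw [Set.indicator_of_notMem h,
        Set.indicator_of_notMem (mt (mem_scaledCell_iff hx y).2 h)]
  rw [e, Measure.integral_comp_smul, integral_sub_right_eq_self (hexagon.indicator g)]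
  simp only [finrank_euclideanSpace, Fintype.card_fin, smul_eq_mul]
  rw [abs_of_pos (by positivity)]

lemma volume_scaledCell :
    (volume (scaledCell R x)).toReal = (R ^ 2)⁻¹ * (volume hexagon).toReal := by
  have := setIntegral_scaledCell hx hR fun _ => 1
  simpa [setIntegral_const, Measure.real] using this

lemma aedisjoint_scaledCell {x' : Site} (hx' : level x' = 0) (hne : x ≠ x') :
    AEDisjoint volume (scaledCell R x) (scaledCell R x') := by
  have hP : planeCoord x ≠ planeCoord x' := fun h => hne (planeCoord_injOn hx hx' h)
  have h0 := Measure.addHaar_affineSubspace (volume : Measure Plane) _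
    (mt AffineSubspace.perpBisector_eq_top.1 hP)
  refine measure_mono_null (t := (R • ·) ⁻¹'
    (AffineSubspace.perpBisector (planeCoord x) (planeCoord x') : Set Plane)) ?_ ?_
  · rintro y ⟨h, h'⟩
    rw [Set.mem_preimage, SetLike.mem_coe, AffineSubspace.mem_perpBisector_iff_dist_eq]
    exact le_antisymm (h x' hx') (h' x hx)
  · rw [Measure.addHaar_preimage_smul _ hR.ne', h0, mul_zero]

end rescaling

lemma scaledCell_subset {R : ℝ} {Γ : Finset Site} {x : Site} (hx : x ∈ Γ) : scaledCell R x ⊆ rescaledRegion R Γ := by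
  rw [rescaledRegion_eq]
  exact Set.subset_biUnion_of_mem (u := fun x => scaledCell R x) hx

section region

variable {R : ℝ} (hR : 0 < R) {Γ : Finset Site} (hΓ : ∀ x ∈ Γ, level x = 0)
include hR hΓ

lemma isCompact_rescaledRegion : IsCompact (rescaledRegion R Γ) := by
  rw [rescaledRegion_eq]
  exact Γ.isCompact_biUnion fun x hx => isCompact_scaledCell (hΓ x hx) hR

lemma volume_rescaledRegion :
    (volume (rescaledRegion R Γ)).toReal =
      Γ.card * ((R ^ 2)⁻¹ * (volume hexagon).toReal) := by
  rw [rescaledRegion_eq, measure_biUnion_finset₀, ENNReal.toReal_sum, ← nsmul_eq_mul,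
    ← Finset.sum_const]
  · exact Finset.sum_congr rfl fun x hx => volume_scaledCell (hΓ x hx) hR
  · exact fun x hx => (isCompact_scaledCell (hΓ x hx) hR).measure_ne_top
  · exact fun x hx x' hx' hne => aedisjoint_scaledCell (hΓ x hx) hR (hΓ x' hx') hne
  · exact fun x hx => (isCompact_scaledCell (hΓ x hx) hR).measurableSet.nullMeasurableSet

lemma setIntegral_rescaledRegion_le {g : Plane → ℝ} (hg : Continuous g) (h0 : ∀ y, 0 ≤ g y) :
    ∫ y in rescaledRegion R Γ, g y ≤ ∑ x ∈ Γ, ∫ y in scaledCell R x, g y := by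
  have hi : ∀ x ∈ Γ, Integrable ((scaledCell R x).indicator g) := fun x hx =>
    (hg.continuousOn.integrableOn_compact (isCompact_scaledCell (hΓ x hx) hR)).integrable_indicator
      (isCompact_scaledCell (hΓ x hx) hR).measurableSet
  have hc := isCompact_rescaledRegion hR hΓ
  rw [← integral_indicator hc.measurableSet]
  have e : ∑ x ∈ Γ, ∫ y in scaledCell R x, g y =
      ∫ y, ∑ x ∈ Γ, (scaledCell R x).indicator g y := by
    rw [integral_finsetSum _ hi]
    exact Finset.sum_congr rfl fun x hx =>
      (integral_indicator (isCompact_scaledCell (hΓ x hx) hR).measurableSet).symm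
  rw [e]
  refine integral_mono ((hg.continuousOn.integrableOn_compact hc).integrable_indicator
    hc.measurableSet) (integrable_finsetSum _ hi) fun y => ?_
  have hnn : ∀ x ∈ Γ, 0 ≤ (scaledCell R x).indicator g y := fun x _ =>
    Set.indicator_nonneg (fun y _ => h0 y) y
  by_cases h : y ∈ rescaledRegion R Γ
  · rw [Set.indicator_of_mem h]
    rw [rescaledRegion_eq] at h
    simp only [Set.mem_iUnion] at h
    obtain ⟨x, hx, hy⟩ := h
    have := Finset.single_le_sum hnn hx
    rwa [Set.indicator_of_mem hy] at this
  · rw [Set.indicator_of_notMem h]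
    exact Finset.sum_nonneg hnn

lemma abs_le_supNorm {g : Plane → ℝ} (hg : Continuous g) {y : Plane}
    (hy : y ∈ rescaledRegion R Γ) : |g y| ≤ supNorm (rescaledRegion R Γ) g := by
  have hc := (isCompact_rescaledRegion hR hΓ).bddAbove_image (f := fun y => |g y|)
    hg.abs.continuousOn
  refine le_ciSup (f := fun y : rescaledRegion R Γ => |g y|) ?_ ⟨y, hy⟩
  rwa [Set.image_eq_range] at hc

end region

lemma fderiv_apply_eq (f : Plane → ℝ) (w v : Plane) :
    fderiv ℝ f w v = v 0 * fderiv ℝ f w (EuclideanSpace.single 0 1) +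
      v 1 * fderiv ℝ f w (EuclideanSpace.single 1 1) := by
  have : v = v 0 • EuclideanSpace.single 0 (1 : ℝ) + v 1 • EuclideanSpace.single 1 (1 : ℝ) := by
    ext i
    fin_cases i <;> simp
  conv_lhs => rw [this]
  simp

lemma sq_sub_sq_le_of_convex {f : Plane → ℝ} (hf : Differentiable ℝ f) {s : Set Plane}
    (hs : Convex ℝ s) {F D : ℝ} (hF : ∀ w ∈ s, |f w| ≤ F)
    (hD0 : ∀ w ∈ s, |fderiv ℝ f w (EuclideanSpace.single 0 1)| ≤ D)
    (hD1 : ∀ w ∈ s, |fderiv ℝ f w (EuclideanSpace.single 1 1)| ≤ D) {y p : Plane}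
    (hy : y ∈ s) (hp : p ∈ s) :
    f y ^ 2 ≤ f p ^ 2 + 2 * F * D * (|y 0 - p 0| + |y 1 - p 1|) := by
  have hmem : ∀ τ ∈ Set.Icc (0 : ℝ) 1, p + τ • (y - p) ∈ s := fun τ hτ => by
    have := hs hp hy (sub_nonneg.2 hτ.2) hτ.1 (by ring)
    convert this using 1
    module
  have hd : ∀ τ : ℝ, HasDerivAt (fun τ : ℝ => f (p + τ • (y - p)) ^ 2)
      (2 * f (p + τ • (y - p)) * fderiv ℝ f (p + τ • (y - p)) (y - p)) τ := by
    intro τ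
    have h1 : HasDerivAt (fun τ : ℝ => p + τ • (y - p)) (y - p) τ := by
      have := ((hasDerivAt_id τ).smul_const (y - p)).const_add p
      rwa [one_smul] at this
    have h2 := ((hf (p + τ • (y - p))).hasFDerivAt.comp_hasDerivAt τ h1).pow 2
    refine h2.congr_deriv ?_
    simp
  have hb := norm_image_sub_le_of_norm_deriv_le_segment_01'
    (C := 2 * F * D * (|y 0 - p 0| + |y 1 - p 1|)) (fun τ _ => (hd τ).hasDerivWithinAt)
    fun τ hτ => by
      have hw := hmem τ (Set.Ico_subset_Icc_self hτ)
      have a1 := hF _ hw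
      have a2 := hD0 _ hw
      have a3 := hD1 _ hw
      have hF0 : 0 ≤ F := (abs_nonneg _).trans a1
      have hD0 : 0 ≤ D := (abs_nonneg _).trans a2
      have b : |fderiv ℝ f (p + τ • (y - p)) (y - p)| ≤ D * (|y 0 - p 0| + |y 1 - p 1|) := by
        rw [fderiv_apply_eq]
        refine (abs_add_le _ _).trans ?_
        rw [abs_mul, abs_mul, PiLp.sub_apply, PiLp.sub_apply, mul_add, mul_comm D, mul_comm D]
        gcongr
      rw [Real.norm_eq_abs, abs_mul, abs_mul, abs_of_pos two_pos]
      calc 2 * |f (p + τ • (y - p))| * |fderiv ℝ f (p + τ • (y - p)) (y - p)|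
          ≤ 2 * F * (D * (|y 0 - p 0| + |y 1 - p 1|)) := by gcongr
        _ = _ := by ring
  simp only [one_smul, zero_smul, add_zero, add_sub_cancel] at hb
  have := (le_abs_self _).trans hb
  linarith

section averages

variable {R : ℝ} (hR : 0 < R) {Γ : Finset Site} (hΓ : ∀ x ∈ Γ, level x = 0)
include hR hΓ

/-- Comparison of a Riemann sum with the integral it approximates. -/
theorem setIntegral_sq_le_sum {f : Plane → ℝ} (hf : ContDiff ℝ ∞ f) {o : Plane}
    (ho : IsOffset o) :
    ∫ y in rescaledRegion R Γ, f y ^ 2 ≤ ((R ^ 2)⁻¹ * (volume hexagon).toReal) *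
      (∑ x ∈ Γ, f (R⁻¹ • (planeCoord x + o)) ^ 2 + Γ.card * (√6 / R *
        derivSupNorm (rescaledRegion R Γ) f * supNorm (rescaledRegion R Γ) f)) := by
  set F := supNorm (rescaledRegion R Γ) f
  set D := derivSupNorm (rescaledRegion R Γ) f
  have hdiff : Differentiable ℝ f := hf.differentiable (by simp)
  have hcont := hf.continuous
  have hfd : Continuous (fderiv ℝ f) := hf.continuous_fderiv (by simp)
  refine (setIntegral_rescaledRegion_le hR hΓ (hcont.pow 2) fun y => sq_nonneg _).trans ?_
  rw [← nsmul_eq_mul, ← Finset.sum_const, ← Finset.sum_add_distrib, Finset.mul_sum]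
  refine Finset.sum_le_sum fun x hx => ?_
  have hcell := isCompact_scaledCell (hΓ x hx) hR
  set p := R⁻¹ • (planeCoord x + o) with hp
  have hpm : p ∈ scaledCell R x := mem_scaledCell_of_isOffset (hΓ x hx) hR ho
  have hsub : scaledCell R x ⊆ rescaledRegion R Γ := scaledCell_subset hx
  have hF : ∀ w ∈ scaledCell R x, |f w| ≤ F := fun w hw => abs_le_supNorm hR hΓ hcont (hsub hw)
  have hF0 : 0 ≤ F := (abs_nonneg _).trans (hF p hpm)
  have hD0 : ∀ w ∈ scaledCell R x, |fderiv ℝ f w (EuclideanSpace.single 0 1)| ≤ D := fun w hw =>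
    (abs_le_supNorm hR hΓ (g := fun y => fderiv ℝ f y (EuclideanSpace.single 0 1))
      (by fun_prop) (hsub hw)).trans (le_max_left _ _)
  have hD1 : ∀ w ∈ scaledCell R x, |fderiv ℝ f w (EuclideanSpace.single 1 1)| ≤ D := fun w hw =>
    (abs_le_supNorm hR hΓ (g := fun y => fderiv ℝ f y (EuclideanSpace.single 1 1))
      (by fun_prop) (hsub hw)).trans (le_max_right _ _)
  have hD : 0 ≤ D := (abs_nonneg _).trans (hD0 p hpm)
  have hdist : ∀ y : Plane, |y 0 - p 0| + |y 1 - p 1| =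
      R⁻¹ * (|(R • y - planeCoord x) 0 - o 0| + |(R • y - planeCoord x) 1 - o 1|) := by
    intro y
    have e : ∀ i, y i - p i = R⁻¹ * ((R • y - planeCoord x) i - o i) := by
      intro i
      simp only [hp, PiLp.sub_apply, PiLp.smul_apply, PiLp.add_apply, smul_eq_mul]
      field_simp
      ring
    rw [e, e, abs_mul, abs_mul, abs_of_pos (inv_pos.2 hR), mul_add]
  let g : Plane → ℝ := fun w => f p ^ 2 + 2 * F * D * R⁻¹ * (|w 0 - o 0| + |w 1 - o 1|)
  have hg : Continuous g := by fun_prop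
  have hpt : ∀ y ∈ scaledCell R x, f y ^ 2 ≤ g (R • y - planeCoord x) := by
    intro y hy
    have := sq_sub_sq_le_of_convex hdiff (convex_scaledCell (hΓ x hx)) hF hD0 hD1 hy hpm
    rw [hdist] at this
    simp only [g]
    linarith
  have hi : ∀ g : Plane → ℝ, Continuous g → IntegrableOn g (scaledCell R x) := fun g hg =>
    hg.continuousOn.integrableOn_compact hcell
  have hih : ∀ g : Plane → ℝ, Continuous g → IntegrableOn g hexagon := fun g hg =>
    hg.continuousOn.integrableOn_compact isCompact_hexagon
  refine (setIntegral_mono_on (hi _ (by fun_prop)) (hi _ (by fun_prop)) hcell.measurableSet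
    hpt).trans ?_
  rw [setIntegral_scaledCell (hΓ x hx) hR g, integral_add (hih _ (by fun_prop)) (hih _ (by fun_prop)),
    integral_const_mul, setIntegral_const, smul_eq_mul, mul_assoc (R ^ 2)⁻¹]
  refine mul_le_mul_of_nonneg_left ?_ (by positivity)
  have hmain := mul_le_mul_of_nonneg_left (setIntegral_hexagon_dist_le ho)
    (show (0 : ℝ) ≤ 2 * F * D * R⁻¹ by positivity)
  change (volume hexagon).toReal * f p ^ 2 + _ ≤ _
  have e : 2 * F * D * R⁻¹ * (√6 / 2 * (volume hexagon).toReal) =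
      (volume hexagon).toReal * (√6 / R * D * F) := by
    field_simp
  rw [e] at hmain
  linarith

end averages

/-! ### Decay of the grand canonical expectation -/

lemma sq_div_four_sub_le_sin_half_sq (x : ℝ) :
    x ^ 2 / 4 - x ^ 4 / 48 ≤ Real.sin (x / 2) ^ 2 := by
  wlog h : 0 < x generalizing x
  · rcases (not_lt.1 h).eq_or_lt with rfl | h'
    · simp
    · have := this (-x) (by linarith)
      rwa [neg_sq, neg_div, Real.sin_neg, neg_sq, show (-x) ^ 4 = x ^ 4 by ring] at this
  rcases le_or_gt (x ^ 2) 12 with h12 | h12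
  · have h1 := Real.sin_gt_sub_cube (x := x / 2) (by linarith)
    have h2 : 0 ≤ x / 2 - (x / 2) ^ 3 / 6 := by
      have : 0 ≤ x * (24 - x ^ 2) := mul_nonneg h.le (by linarith)
      nlinarith
    calc x ^ 2 / 4 - x ^ 4 / 48 ≤ x ^ 2 / 4 - x ^ 4 / 48 + x ^ 6 / 2304 := by
          have : 0 ≤ x ^ 6 / 2304 := by positivity
          linarith
      _ = (x / 2 - (x / 2) ^ 3 / 6) ^ 2 := by ring
      _ ≤ _ := by gcongr
  · refine le_trans ?_ (sq_nonneg _)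
    nlinarith

lemma rpow_le_four_mul_levelProb {q : ℝ} (hq0 : 0 < q) (hq1 : q < 1) {μ δ : ℝ} {l : ℤ}
    (hδ : |(l : ℝ) - μ| = δ) :
    q ^ (2 * δ) ≤ 4 * (levelProb q μ l * (1 - levelProb q μ l)) := by
  have hδ0 : 0 ≤ δ := hδ ▸ abs_nonneg _
  set b := q ^ (2 * δ) with hb
  have hb0 : 0 < b := Real.rpow_pos_of_pos hq0 _
  have hb1 : b ≤ 1 := Real.rpow_le_one hq0.le hq1.le (by linarith)
  have e : levelProb q μ l * (1 - levelProb q μ l) = b / (1 + b) ^ 2 := by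
    rcases abs_cases ((l : ℝ) - μ) with h | h
    · have : q ^ (2 * ((l : ℝ) - μ)) = b := by rw [hb, ← hδ, h.1]
      rw [levelProb, this]
      field_simp
      ring
    · have : q ^ (2 * ((l : ℝ) - μ)) = b⁻¹ := by
        rw [hb, ← hδ, h.1, ← Real.rpow_neg hq0.le]
        congr 1
        ring
      rw [levelProb, this]
      field_simp
      ring
  rw [e, mul_div_assoc', le_div_iff₀ (by positivity)]
  nlinarith [mul_pos hb0 hb0]

lemma exists_stickLevel_abs_sub_eq {L : ℕ} (hL : Even L) {μ : ℝ} (hμ : |μ| ≤ (L : ℝ) / 2) :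
    ∃ l ∈ stickLevels L, |(l : ℝ) - μ| = latticeDist μ := by
  obtain ⟨k, rfl⟩ := hL
  rw [abs_le] at hμ
  push_cast at hμ
  have hk : (((k + k : ℕ) : ℤ) / 2) = k := by omega
  have h1 : -(k : ℤ) ≤ ⌊μ⌋ := Int.le_floor.2 (by push_cast; linarith)
  have h2 : ⌊μ⌋ ≤ (k : ℤ) := by
    have := Int.floor_le μ
    have : (⌊μ⌋ : ℝ) ≤ (k : ℤ) := by push_cast; linarith
    exact_mod_cast this
  rcases le_or_gt |μ - ⌊μ⌋| |1 - μ + ⌊μ⌋| with h | h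
  · refine ⟨⌊μ⌋, Finset.mem_Icc.2 (by rw [hk]; exact ⟨h1, h2⟩), ?_⟩
    rw [latticeDist, min_eq_left h, abs_sub_comm]
  · refine ⟨⌊μ⌋ + 1, Finset.mem_Icc.2 (by
      rw [hk]
      refine ⟨by omega, ?_⟩
      rcases h2.eq_or_lt with h2 | h2
      · exfalso
        have h3 := Int.floor_le μ
        rw [h2] at h h3
        push_cast at h h3
        have : μ = k := by linarith
        rw [this] at h
        simp at h
        linarith
      · omega), ?_⟩
    rw [latticeDist, min_eq_right h.le]
    push_cast
    congr 1
    ring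

/-- The Gaussian bound for the sum of the squared sines of the phases of one layer. -/
lemma le_sum_sin_half_sq {R S : ℝ} (hR : 0 < R) {Γ : Finset Site} (hΓ : ∀ x ∈ Γ, level x = 0)
    (hne : Γ.Nonempty) {f : Plane → ℝ} (hf : ContDiff ℝ ∞ f) {o : Plane} (ho : IsOffset o) :
    (Γ.card : ℝ) * S ^ 2 / (4 * R ^ 2) * ((∫ y in rescaledRegion R Γ, f y ^ 2) /
        (volume (rescaledRegion R Γ)).toReal -
        √6 / R * derivSupNorm (rescaledRegion R Γ) f * supNorm (rescaledRegion R Γ) f -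
        S ^ 2 / (12 * R ^ 2) * supNorm (rescaledRegion R Γ) f ^ 4) ≤
      ∑ x ∈ Γ, Real.sin (S / R * f (R⁻¹ • (planeCoord x + o)) / 2) ^ 2 := by
  have hm : (0 : ℝ) < Γ.card := by exact_mod_cast hne.card_pos
  have hv : 0 < (R ^ 2)⁻¹ * (volume hexagon).toReal := by
    have := volume_hexagon_pos
    positivity
  have havg := setIntegral_sq_le_sum hR hΓ hf ho
  rw [volume_rescaledRegion hR hΓ]
  set F := supNorm (rescaledRegion R Γ) f
  set D := derivSupNorm (rescaledRegion R Γ) f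
  set I := ∫ y in rescaledRegion R Γ, f y ^ 2
  set v := (R ^ 2)⁻¹ * (volume hexagon).toReal
  have h1 : (Γ.card : ℝ) * (I / (Γ.card * v)) ≤
      ∑ x ∈ Γ, f (R⁻¹ • (planeCoord x + o)) ^ 2 + Γ.card * (√6 / R * D * F) := by
    have e : (Γ.card : ℝ) * (I / (Γ.card * v)) = I / v := by field_simp
    rw [e, div_le_iff₀ hv, mul_comm _ v]
    exact havg
  have h2 : ∑ x ∈ Γ, (S ^ 2 / (4 * R ^ 2) * f (R⁻¹ • (planeCoord x + o)) ^ 2 -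
      S ^ 4 / (48 * R ^ 4) * F ^ 4) ≤
      ∑ x ∈ Γ, Real.sin (S / R * f (R⁻¹ • (planeCoord x + o)) / 2) ^ 2 := by
    refine Finset.sum_le_sum fun x hx => ?_
    refine le_trans ?_ (sq_div_four_sub_le_sin_half_sq _)
    have hmem := scaledCell_subset hx (mem_scaledCell_of_isOffset (hΓ x hx) hR ho)
    have hle := abs_le_supNorm hR hΓ hf.continuous hmem
    have h4 : f (R⁻¹ • (planeCoord x + o)) ^ 4 ≤ F ^ 4 := by
      rw [← (show Even 4 by decide).pow_abs]
      gcongr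
    have h5 := mul_le_mul_of_nonneg_left h4 (show 0 ≤ S ^ 4 / (48 * R ^ 4) by positivity)
    have e1 : (S / R * f (R⁻¹ • (planeCoord x + o))) ^ 2 / 4 =
      S ^ 2 / (4 * R ^ 2) * f (R⁻¹ • (planeCoord x + o)) ^ 2 := by field_simp
    have e2 : (S / R * f (R⁻¹ • (planeCoord x + o))) ^ 4 / 48 =
      S ^ 4 / (48 * R ^ 4) * f (R⁻¹ • (planeCoord x + o)) ^ 4 := by field_simp
    rw [e1, e2]
    linarith
  refine le_trans ?_ h2
  rw [Finset.sum_sub_distrib, ← Finset.mul_sum, Finset.sum_const, nsmul_eq_mul]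
  have h3 := mul_le_mul_of_nonneg_left h1 (show 0 ≤ S ^ 2 / (4 * R ^ 2) by positivity)
  have e3 : (Γ.card : ℝ) * S ^ 2 / (4 * R ^ 2) * (I / (Γ.card * v) - √6 / R * D * F -
      S ^ 2 / (12 * R ^ 2) * F ^ 4) = S ^ 2 / (4 * R ^ 2) * (Γ.card * (I / (Γ.card * v))) -
      S ^ 2 / (4 * R ^ 2) * (Γ.card * (√6 / R * D * F)) -
      Γ.card * (S ^ 4 / (48 * R ^ 4) * F ^ 4) := by
    have : S ^ 2 / (4 * R ^ 2) * (S ^ 2 / (12 * R ^ 2)) = S ^ 4 / (48 * R ^ 4) := by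
      field_simp
      ring
    rw [← this]
    ring
  rw [e3]
  linarith

/-- The grand canonical expectation of the phase operator of a slowly varying phase. -/
theorem norm_sq_gcExpectation_phaseOp_le {q : ℝ} (hq0 : 0 < q) (hq1 : q < 1) {L : ℕ}
    (hL : Even L) {Γ Γ₀ : Finset Site} (hΓ : ∀ x ∈ Γ, level x = 0) (hsub : Γ₀ ⊆ Γ)
    (hne : Γ₀.Nonempty) {μ : ℝ} (hμ : |μ| ≤ (L : ℝ) / 2) {R S : ℝ} {f : Plane → ℝ} (hR : 0 < R)
    (hf : ContDiff ℝ ∞ f) :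
    ‖gcExpectation q (cylinder Γ L) μ (phaseOp (cylinder Γ L)
        (ansatzPhase S R f (cylinder Γ₀ L)))‖ ^ 2 ≤
      Real.exp (-(q ^ (2 * latticeDist μ) * ((Γ₀.card : ℝ) * S ^ 2 / (4 * R ^ 2) *
        ((∫ y in rescaledRegion R Γ₀, f y ^ 2) / (volume (rescaledRegion R Γ₀)).toReal -
        √6 / R * derivSupNorm (rescaledRegion R Γ₀) f * supNorm (rescaledRegion R Γ₀) f -
        S ^ 2 / (12 * R ^ 2) * supNorm (rescaledRegion R Γ₀) f ^ 4)))) := by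
  obtain ⟨l, hl, hlμ⟩ := exists_stickLevel_abs_sub_eq hL hμ
  have hΓ₀ : ∀ x ∈ Γ₀, level x = 0 := fun x hx => hΓ x (hsub hx)
  set φ := ansatzPhase S R f (cylinder Γ₀ L) with hφ
  rw [gcExpectation_phaseOp hq0]
  refine (norm_sq_eval_bernPoly_exp_le (p := fun x => levelProb q μ (level x)) (cylinder Γ L)
    φ).trans (Real.exp_le_exp.2 (neg_le_neg ?_))
  have hnn : ∀ x, 0 ≤ 4 * (levelProb q μ (level x) * (1 - levelProb q μ (level x))) *
      Real.sin (φ x / 2) ^ 2 := by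
    intro x
    have h1 := (levelProb_pos hq0 μ (level x)).le
    have h2 := sub_nonneg.2 (levelProb_lt_one hq0 μ (level x)).le
    positivity
  have hlayer : ∑ y ∈ Γ₀, 4 * (levelProb q μ l * (1 - levelProb q μ l)) *
      Real.sin (S / R * f (R⁻¹ • (planeCoord y + planeCoord (stickSite l))) / 2) ^ 2 ≤
      ∑ x ∈ cylinder Γ L, 4 * (levelProb q μ (level x) * (1 - levelProb q μ (level x))) *
        Real.sin (φ x / 2) ^ 2 := by
    rw [sum_cylinder hΓ]
    refine le_trans (Finset.sum_le_sum fun y hy => ?_) (Finset.sum_le_sum_of_subset_of_nonneg hsub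
      fun y _ _ => Finset.sum_nonneg fun l _ => hnn _)
    refine le_trans (le_of_eq ?_) (Finset.single_le_sum (fun l _ => hnn _) hl)
    have hmem : y + stickSite l ∈ cylinder Γ₀ L := by
      rw [cylinder_eq_image]
      exact Finset.mem_image.2 ⟨(y, l), Finset.mem_product.2 ⟨hy, hl⟩, rfl⟩
    rw [level_add_stickSite hΓ₀ hy, hφ, ansatzPhase, if_pos hmem, planeCoord_add]
  refine le_trans ?_ hlayer
  rw [← Finset.mul_sum]
  have hp := rpow_le_four_mul_levelProb hq0 hq1 hlμ
  have hsum := le_sum_sin_half_sq (S := S) hR hΓ₀ hne hf (isOffset_planeCoord_stickSite l)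
  exact (mul_le_mul_of_nonneg_left hsum (Real.rpow_pos_of_pos hq0 _).le).trans
    (mul_le_mul_of_nonneg_right hp (Finset.sum_nonneg fun y _ => sq_nonneg _))

end

end XXZ

end

theorem mainTheorem5 (q : ℝ) (hq0 : 0 < q) (hq1 : q < 1) (L : ℕ) (hL : Even L)
    (Γ Γ₀ : Finset XXZ.Site) (hΓ : ∀ x ∈ Γ, XXZ.level x = 0) (hsub : Γ₀ ⊆ Γ)
    (hne : Γ₀.Nonempty) (μ : ℝ) :
    (∀ (n : ℕ) (φ : XXZ.Site → ℝ),
      (∀ x, x ∉ XXZ.cylinder Γ₀ L → φ x = 0) →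
      XXZ.gcExpectation q (XXZ.stick L) μ (XXZ.numberOp (XXZ.stick L)) =
        (n : ℂ) / ((XXZ.cylinder Γ L).card : ℂ) * ((L : ℂ) + 1) →
      2 * (Γ₀.card : ℝ) < q ^ 2 * √(Γ.card : ℝ) →
      ‖inner ℂ (XXZ.groundState q (XXZ.cylinder Γ L) n)
              (XXZ.perturbedState q (XXZ.cylinder Γ L) n φ) /
            inner ℂ (XXZ.groundState q (XXZ.cylinder Γ L) n)
              (XXZ.groundState q (XXZ.cylinder Γ L) n) -
          XXZ.gcExpectation q (XXZ.cylinder Γ L) μ (XXZ.phaseOp (XXZ.cylinder Γ L) φ)‖ ≤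
        (Real.log ((Γ.card : ℝ) - Γ₀.card) ^ 2
              + 2 * (1 + (2 * |Real.log q|) ^ 2) * (Γ₀.card : ℝ) ^ 2 + 4) /
            (2 * ((Γ.card : ℝ) - Γ₀.card))
          + 4 * (Γ₀.card : ℝ) / (q ^ 2 * √(Γ.card : ℝ) - 2 * Γ₀.card)) ∧
    (|μ| ≤ (L : ℝ) / 2 →
      ∀ (R S : ℝ) (f : EuclideanSpace ℝ (Fin 2) → ℝ), 0 < R → ContDiff ℝ ∞ f →
      ENNReal.log (‖XXZ.gcExpectation q (XXZ.cylinder Γ L) μ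
          (XXZ.phaseOp (XXZ.cylinder Γ L)
            (XXZ.ansatzPhase S R f (XXZ.cylinder Γ₀ L)))‖ₑ ^ 2) ≤
        ((-(q ^ (2 * XXZ.latticeDist μ) * ((Γ₀.card : ℝ) * S ^ 2 / (4 * R ^ 2)) *
          ((∫ y in XXZ.rescaledRegion R Γ₀, f y ^ 2) /
              (MeasureTheory.volume (XXZ.rescaledRegion R Γ₀)).toReal
            - √6 / R * XXZ.derivSupNorm (XXZ.rescaledRegion R Γ₀) f *
                XXZ.supNorm (XXZ.rescaledRegion R Γ₀) f
            - S ^ 2 / (12 * R ^ 2) * XXZ.supNorm (XXZ.rescaledRegion R Γ₀) f ^ 4)) : ℝ) :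
          EReal)) := by
  refine ⟨fun n φ hφ hμ hlt => ?_, fun hμ R S f hR hf => ?_⟩
  · refine (XXZ.norm_canonical_sub_gcExpectation_le hq0 hq1 hL hΓ hsub hne hφ hμ hlt).trans ?_
    refine le_add_of_nonneg_left (div_nonneg (by positivity) ?_)
    have : (Γ₀.card : ℝ) ≤ Γ.card := by exact_mod_cast Finset.card_le_card hsub
    linarith
  · have h := XXZ.norm_sq_gcExpectation_phaseOp_le hq0 hq1 hL hΓ hsub hne hμ (S := S) hR hf
    have h2 := ENNReal.log_monotone (ENNReal.ofReal_le_ofReal h)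
    rw [mul_assoc (q ^ _)]
    rwa [ENNReal.log_ofReal_of_pos (Real.exp_pos _), Real.log_exp,
      ENNReal.ofReal_pow (norm_nonneg _), ofReal_norm] at h2
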